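/- **Setting.** Let $\Sigma$ be a finite set of propositions. A timed word over $\Sigma$ is a finite sequence $\rho=(\sigma_1,\tau_1)\cdots(\sigma_n,\tau_n)$, $n\ge 1$, with $\emptyset\neq\sigma_i\subseteq\Sigma$, $\tau_i\in\mathbb R$ and $0=\tau_1\le\tau_2\le\dots\le\tau_n$; $\mathrm{dom}(\rho)=\{1,\dots,n\}$. Intervals are open, half-open or closed; $\mathcal I_{\mathsf{int}}$ are those with endpoints in $\mathbb Z\cup\{-\infty,\infty\}$, $\mathcal I_{\mathsf{nat}}$ those with endpoints in $\mathbb N\cup\{\infty\}$ (where $0\in\mathbb N$); $\inf I$ and $\sup I$ denote the lower and upper endpoint of $I$. **1-TPTL.** Formulae with the single freeze variable $x$ are built from $a\in\Sigma$, $\top$, $\bot$ and constraints $T-x\in I$ ($I\in\mathcal I_{\mathsf{int}}$) with $\neg,\wedge,\vee,\mathsf U,\mathsf S,\Box,\boxminus$ and $x.\varphi$ (a constraint $x-T\in I$ abbreviates $T-x\in -I$). With $\nu\in\mathbb R$ the value of $x$: $\rho,i,\nu\models a$ iff $a\in\sigma_i$; $\rho,i,\nu\models T-x\in I$ iff $\tau_i-\nu\in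 I$; $\rho,i,\nu\models x.\varphi$ iff $\rho,i,\tau_i\models\varphi$; $\rho,i,\nu\models\varphi\,\mathsf U\,\psi$ iff there is $j\in\mathrm{dom}(\rho)$, $j>i$, with $\rho,j,\nu\models\psi$ and $\rho,l,\nu\models\varphi$ for all $i<l<j$; $\mathsf S$ is symmetric; $\Box\varphi$ ($\boxminus\varphi$) says that $\varphi$ holds at all $j>i$ (all $j<i$) in $\mathrm{dom}(\rho)$; Boolean connectives are as usual. We write $\rho,i\models\varphi$ for $\rho,i,0\models\varphi$. $I_\nu(\varphi)$ is the set of intervals occurring in $\varphi$. A formula is in negation normal form if $\neg$ is applied only to propositions. **PnEMTL.** Formulae: $\alpha::=a\mid\alpha\wedge\alpha\mid\neg\alpha\mid\mathcal F^k_{I_1,\dots,I_k}(A_1,\dots,A_{k+1})(S)\mid\mathcal P^k_{I_1,\dots,I_k}(A_1,\dots,A_{k+1})(S)$ with $k\ge1$, $I_w\in\mathcal I_{\mathsf{nat}}$, $S$ a finite set of PnEMTL formulae and $A_w$ nondeterministic finite automata over the alphabet $2^S$. For $z\in\mathrm{dom}(\rho)$ let $b_z=\{\beta\in S:\rho,z\models\beta\}$.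 Then $\rho,i_0\models\mathcal F^k_{I_1,\dots,I_k}(A_1,\dots,A_{k+1})(S)$ iff there are $i_0\le i_1\le\dots\le i_k\le n$ such that $\tau_{i_w}-\tau_{i_0}\in I_w$ and $b_{i_{w-1}+1}b_{i_{w-1}+2}\cdots b_{i_w}\in L(A_w)$ for $1\le w\le k$, and $b_{i_k+1}\cdots b_n\in L(A_{k+1})$. Symmetrically, $\rho,i_0\models\mathcal P^k_{I_1,\dots,I_k}(A_1,\dots,A_{k+1})(S)$ iff there are $i_0\ge i_1\ge\dots\ge i_k\ge1$ such that $\tau_{i_0}-\tau_{i_w}\in I_w$ and $b_{i_{w-1}-1}b_{i_{w-1}-2}\cdots b_{i_w}\in L(A_w)$ for $1\le w\le k$, and $b_{i_k-1}\cdots b_1\in L(A_{k+1})$. (These words may be empty.) The arity of $\alpha$ is the largest $k$ of a modality occurring in $\alpha$ ($0$ if there is none). **Size.** $|\varphi|$ and $|\alpha|$ are the lengths of the formulae with integer constants written in binary; in $|\alpha|$ an automaton counts with its number of states plus its number of transitions, and repeated subformulae are counted repeatedly. **Adjacency.** A set $\mathcal I$ of intervals is non-adjacent (positively non-adjacent,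 negatively non-adjacent) if for all $I,J\in\mathcal I$, including $I=J$, $\sup I=\inf J$ implies $\sup I=0$ ($\sup I\le0$, $\sup I\ge0$, respectively). A 1-TPTL formula is non-adjacent (positively, negatively non-adjacent) if it is in negation normal form and, for each freeze quantifier in it, the set of intervals of the constraints bound by that quantifier has that property. A PnEMTL formula is positively (negatively) non-adjacent if for every $\mathcal F$-modality ($\mathcal P$-modality) occurring in it, the set $\{I_1,\dots,I_k\}$ of its intervals is non-adjacent; it is non-adjacent if both hold. **Theorem.** There are a polynomial $P$ and a constant $C$ such that for every finite $\Sigma$ and every 1-TPTL formula $\varphi$ over $\Sigma$ there is a PnEMTL formula $\alpha$ over $\Sigma$ with 1. $\rho,i\models\varphi$ if and only if $\rho,i\models\alpha$, for every timed word $\rho$ over $\Sigma$ and every $i\in\mathrm{dom}(\rho)$; 2. $|\alpha|\le 2^{P(|\varphi|)}$; 3. the arity of $\alpha$ is at most $C\cdot\max(1,|I_\nu(\varphi)|^2)$; 4. if $\varphi$ is non-adjacent (respectively positively non-adjacent, negatively non-adjacent), then $\alpha$ is non-adjacent (respectively positively non-adjacent, negatively non-adjacent). -/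

import Mathlib

/-! ### Finite timed words -/

/-- A finite timed word over the set `AP` of propositions. Positions are numbered from `1` to `len`;
the values of `letter` and `time` at other indices are irrelevant and never inspected. -/
structure TimedWord (AP : Type*) where
  len : ℕ
  letter : ℕ → Set AP
  time : ℕ → ℝ
  len_pos : 1 ≤ len
  letter_nonempty : ∀ i, 1 ≤ i → i ≤ len → (letter i).Nonempty
  time_one : time 1 = 0
  time_mono : ∀ i j, 1 ≤ i → i ≤ j → j ≤ len → time i ≤ time j

/-- The set of positions of a timed word. -/
def TimedWord.dom {AP : Type*} (ρ : TimedWord AP) : Set ℕ := {i | 1 ≤ i ∧ i ≤ ρ.len}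

/-! ### Intervals -/

/-- An end of an interval: infinite, or an excluded or included integer endpoint. -/
inductive Endpoint where
  | infinite : Endpoint
  | excluded (a : ℤ) : Endpoint
  | included (a : ℤ) : Endpoint

/-- The length of an endpoint, with integer constants written in binary. -/
def Endpoint.size : Endpoint → ℕ
  | infinite => 1
  | excluded a => 1 + a.natAbs.size
  | included a => 1 + a.natAbs.size

/-- The endpoint `-e`. -/
def Endpoint.neg : Endpoint → Endpoint
  | infinite => infinite
  | excluded a => excluded (-a)
  | included a => included (-a)

/-- An open, half-open or closed interval with endpoints in `ℤ ∪ {-∞, ∞}`. An infinite lower end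
is `-∞`, an infinite upper end is `∞`. -/
structure TimeInterval where
  lower : Endpoint
  upper : Endpoint

namespace TimeInterval

/-- The lower endpoint. -/
noncomputable def inf (I : TimeInterval) : EReal :=
  match I.lower with
  | .infinite => ⊥
  | .excluded a => ((a : ℝ) : EReal)
  | .included a => ((a : ℝ) : EReal)

/-- The upper endpoint. -/
noncomputable def sup (I : TimeInterval) : EReal :=
  match I.upper with
  | .infinite => ⊤
  | .excluded a => ((a : ℝ) : EReal)
  | .included a => ((a : ℝ) : EReal)

/-- The set of real numbers denoted by an interval. -/
def toSet (I : TimeInterval) : Set ℝ :=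
  {r | (match I.lower with
        | .infinite => True
        | .excluded a => (a : ℝ) < r
        | .included a => (a : ℝ) ≤ r) ∧
       (match I.upper with
        | .infinite => True
        | .excluded a => r < (a : ℝ)
        | .included a => r ≤ (a : ℝ))}

/-- The reflected interval `-I`. -/
def neg (I : TimeInterval) : TimeInterval := ⟨I.upper.neg, I.lower.neg⟩

/-- The endpoints lie in `ℕ ∪ {∞}`. -/
def IsNat (I : TimeInterval) : Prop := 0 ≤ I.inf ∧ 0 ≤ I.sup

/-- The length of an interval, with integer constants written in binary. -/
def size (I : TimeInterval) : ℕ := I.lower.size + I.upper.size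

/-- A set of intervals is non-adjacent: a common value of the supremum of one member and the
infimum of one member (possibly the same one) is zero. -/
def NonAdjacent (s : Set TimeInterval) : Prop :=
  ∀ I ∈ s, ∀ J ∈ s, (I.sup = J.inf → I.sup = 0) ∧ (I.inf = J.sup → I.inf = 0)

/-- A set of intervals is positively non-adjacent. -/
def PosNonAdjacent (s : Set TimeInterval) : Prop :=
  ∀ I ∈ s, ∀ J ∈ s, (I.sup = J.inf → I.sup ≤ 0) ∧ (I.inf = J.sup → I.inf ≤ 0)

/-- A set of intervals is negatively non-adjacent. -/
def NegNonAdjacent (s : Set TimeInterval) : Prop :=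
  ∀ I ∈ s, ∀ J ∈ s, (I.sup = J.inf → 0 ≤ I.sup) ∧ (I.inf = J.sup → 0 ≤ I.inf)

end TimeInterval

/-! ### One-variable TPTL -/

/-- Formulae of 1-TPTL. There is a single freeze variable `x`, so it is not named: `freeze φ` is
`x.φ` and `ctr I` is the constraint `T - x ∈ I`. -/
inductive TPTL (AP : Type*) where
  | atom (a : AP) : TPTL AP
  | tt : TPTL AP
  | ff : TPTL AP
  | neg (φ : TPTL AP) : TPTL AP
  | and (φ ψ : TPTL AP) : TPTL AP
  | or (φ ψ : TPTL AP) : TPTL AP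
  | untl (φ ψ : TPTL AP) : TPTL AP
  | snce (φ ψ : TPTL AP) : TPTL AP
  | box (φ : TPTL AP) : TPTL AP
  | boxPast (φ : TPTL AP) : TPTL AP
  | freeze (φ : TPTL AP) : TPTL AP
  | ctr (I : TimeInterval) : TPTL AP

namespace TPTL

variable {AP : Type*}

/-- The constraint `x - T ∈ I`, which is `T - x ∈ -I`. -/
def ctrRev (I : TimeInterval) : TPTL AP := ctr I.neg

/-- `Sat ρ φ i ν` is `ρ, i, ν ⊨ φ`, where `ν` is the value of the freeze variable. -/
def Sat (ρ : TimedWord AP) : TPTL AP → ℕ → ℝ → Prop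
  | atom a, i, _ => a ∈ ρ.letter i
  | tt, i, _ => i ∈ ρ.dom
  | ff, _, _ => False
  | neg φ, i, ν => ¬ Sat ρ φ i ν
  | and φ ψ, i, ν => Sat ρ φ i ν ∧ Sat ρ ψ i ν
  | or φ ψ, i, ν => Sat ρ φ i ν ∨ Sat ρ ψ i ν
  | untl φ ψ, i, ν =>
      ∃ j ∈ ρ.dom, i < j ∧ Sat ρ ψ j ν ∧ ∀ l, i < l → l < j → Sat ρ φ l ν
  | snce φ ψ, i, ν =>
      ∃ j ∈ ρ.dom, j < i ∧ Sat ρ ψ j ν ∧ ∀ l, j < l → l < i → Sat ρ φ l ν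
  | box φ, i, ν => ∀ j ∈ ρ.dom, i < j → Sat ρ φ j ν
  | boxPast φ, i, ν => ∀ j ∈ ρ.dom, j < i → Sat ρ φ j ν
  | freeze φ, i, _ => Sat ρ φ i (ρ.time i)
  | ctr I, i, ν => ρ.time i - ν ∈ I.toSet

/-- The size of a formula: its length, with integer constants written in binary. -/
def size : TPTL AP → ℕ
  | atom _ => 1
  | tt => 1
  | ff => 1
  | neg φ => φ.size + 1
  | and φ ψ => φ.size + ψ.size + 1
  | or φ ψ => φ.size + ψ.size + 1
  | untl φ ψ => φ.size + ψ.size + 1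
  | snce φ ψ => φ.size + ψ.size + 1
  | box φ => φ.size + 1
  | boxPast φ => φ.size + 1
  | freeze φ => φ.size + 1
  | ctr I => I.size + 1

/-- The set of all intervals occurring in a formula. -/
def intervals : TPTL AP → Set TimeInterval
  | atom _ => ∅
  | tt => ∅
  | ff => ∅
  | neg φ => φ.intervals
  | and φ ψ => φ.intervals ∪ ψ.intervals
  | or φ ψ => φ.intervals ∪ ψ.intervals
  | untl φ ψ => φ.intervals ∪ ψ.intervals
  | snce φ ψ => φ.intervals ∪ ψ.intervals
  | box φ => φ.intervals
  | boxPast φ => φ.intervals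
  | freeze φ => φ.intervals
  | ctr I => {I}

theorem intervals_finite (φ : TPTL AP) : φ.intervals.Finite := by
  induction φ <;> simp_all [intervals]

/-- The set of intervals of those constraints of a formula that lie under no freeze quantifier of
this formula; for `x.φ`, these are the constraints of `φ` that its quantifier binds. -/
def scopeIntervals : TPTL AP → Set TimeInterval
  | atom _ => ∅
  | tt => ∅
  | ff => ∅
  | neg φ => φ.scopeIntervals
  | and φ ψ => φ.scopeIntervals ∪ ψ.scopeIntervals
  | or φ ψ => φ.scopeIntervals ∪ ψ.scopeIntervals
  | untl φ ψ => φ.scopeIntervals ∪ ψ.scopeIntervals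
  | snce φ ψ => φ.scopeIntervals ∪ ψ.scopeIntervals
  | box φ => φ.scopeIntervals
  | boxPast φ => φ.scopeIntervals
  | freeze _ => ∅
  | ctr I => {I}

/-- For every freeze quantifier of the formula, the set of intervals of the constraints that it
binds has the property `R`. -/
def EachScope (R : Set TimeInterval → Prop) : TPTL AP → Prop
  | atom _ => True
  | tt => True
  | ff => True
  | neg φ => φ.EachScope R
  | and φ ψ => φ.EachScope R ∧ ψ.EachScope R
  | or φ ψ => φ.EachScope R ∧ ψ.EachScope R
  | untl φ ψ => φ.EachScope R ∧ ψ.EachScope R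
  | snce φ ψ => φ.EachScope R ∧ ψ.EachScope R
  | box φ => φ.EachScope R
  | boxPast φ => φ.EachScope R
  | freeze φ => R φ.scopeIntervals ∧ φ.EachScope R
  | ctr _ => True

/-- Negation normal form: only propositions are negated. -/
def IsNNF : TPTL AP → Prop
  | atom _ => True
  | tt => True
  | ff => True
  | neg φ => ∃ a, φ = atom a
  | and φ ψ => φ.IsNNF ∧ ψ.IsNNF
  | or φ ψ => φ.IsNNF ∧ ψ.IsNNF
  | untl φ ψ => φ.IsNNF ∧ ψ.IsNNF
  | snce φ ψ => φ.IsNNF ∧ ψ.IsNNF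
  | box φ => φ.IsNNF
  | boxPast φ => φ.IsNNF
  | freeze φ => φ.IsNNF
  | ctr _ => True

/-- Non-adjacent 1-TPTL. -/
def NonAdjacent (φ : TPTL AP) : Prop := φ.IsNNF ∧ φ.EachScope TimeInterval.NonAdjacent

/-- Positively non-adjacent 1-TPTL. -/
def PosNonAdjacent (φ : TPTL AP) : Prop := φ.IsNNF ∧ φ.EachScope TimeInterval.PosNonAdjacent

/-- Negatively non-adjacent 1-TPTL. -/
def NegNonAdjacent (φ : TPTL AP) : Prop := φ.IsNNF ∧ φ.EachScope TimeInterval.NegNonAdjacent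

end TPTL

/-! ### PnEMTL -/

/-- A nondeterministic finite automaton whose letters are the subsets of an `m`-element set. -/
structure Automaton (m : ℕ) where
  numStates : ℕ
  nfa : NFA (Set (Fin m)) (Fin numStates)

namespace Automaton

/-- The number of states plus the number of transitions. -/
noncomputable def size {m : ℕ} (A : Automaton m) : ℕ :=
  A.numStates + {t : Fin A.numStates × Set (Fin m) × Fin A.numStates |
    t.2.2 ∈ A.nfa.step t.1 t.2.1}.ncard

end Automaton

/-- Formulae of PnEMTL. In `fut k m _ I A S` and `past k m _ I A S`, which are the future and past
Pnueli automata modalities of arity `k ≥ 1`, the finite set of argument formulae is listed as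
`S 0, …, S (m - 1)`, a letter of an automaton is a set of indices of arguments, the intervals
`I_1, …, I_k` are `I 0, …, I (k - 1)` and the automata `A_1, …, A_{k+1}` are `A 0, …, A k`. -/
inductive PnEMTL (AP : Type*) where
  | atom (a : AP) : PnEMTL AP
  | and (α β : PnEMTL AP) : PnEMTL AP
  | neg (α : PnEMTL AP) : PnEMTL AP
  | fut (k m : ℕ) (hk : 1 ≤ k) (I : Fin k → {I : TimeInterval // I.IsNat})
      (A : Fin (k + 1) → Automaton m) (S : Fin m → PnEMTL AP) : PnEMTL AP
  | past (k m : ℕ) (hk : 1 ≤ k) (I : Fin k → {I : TimeInterval // I.IsNat})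
      (A : Fin (k + 1) → Automaton m) (S : Fin m → PnEMTL AP) : PnEMTL AP

/-- The word `b x, b (x + 1), …, b y`, which is empty if `y < x`. -/
def segPlus {B : Type*} (b : ℕ → B) (x y : ℕ) : List B :=
  (List.range' x (y + 1 - x)).map b

/-- The word `b x, b (x - 1), …, b y`, which is empty if `x < y`. -/
def segMinus {B : Type*} (b : ℕ → B) (x y : ℕ) : List B :=
  (segPlus b y x).reverse

namespace PnEMTL

variable {AP : Type*}

/-- `Sat ρ α i` is `ρ, i ⊨ α`. The letter read at position `z` by the automata of a modality is the
set of (indices of) those arguments of the modality that hold at `z`. -/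
def Sat (ρ : TimedWord AP) : PnEMTL AP → ℕ → Prop
  | atom a, i => a ∈ ρ.letter i
  | and α β, i => Sat ρ α i ∧ Sat ρ β i
  | neg α, i => ¬ Sat ρ α i
  | fut k m _ I A S, i =>
      ∃ p : Fin (k + 1) → ℕ, p 0 = i ∧ Monotone p ∧ p (Fin.last k) ≤ ρ.len ∧
        (∀ w : Fin k,
          ρ.time (p w.succ) - ρ.time i ∈ (I w).1.toSet ∧
          segPlus (fun z => {j : Fin m | Sat ρ (S j) z}) (p w.castSucc + 1) (p w.succ)
            ∈ (A w.castSucc).nfa.accepts) ∧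
        segPlus (fun z => {j : Fin m | Sat ρ (S j) z}) (p (Fin.last k) + 1) ρ.len
          ∈ (A (Fin.last k)).nfa.accepts
  | past k m _ I A S, i =>
      ∃ p : Fin (k + 1) → ℕ, p 0 = i ∧ Antitone p ∧ 1 ≤ p (Fin.last k) ∧
        (∀ w : Fin k,
          ρ.time i - ρ.time (p w.succ) ∈ (I w).1.toSet ∧
          segMinus (fun z => {j : Fin m | Sat ρ (S j) z}) (p w.castSucc - 1) (p w.succ)
            ∈ (A w.castSucc).nfa.accepts) ∧
        segMinus (fun z => {j : Fin m | Sat ρ (S j) z}) (p (Fin.last k) - 1) 1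
          ∈ (A (Fin.last k)).nfa.accepts

/-- The size of a formula: all intervals (with constants in binary), all states and transitions of
automata, and all argument formulae are counted, repeated subformulae repeatedly. -/
noncomputable def size : PnEMTL AP → ℕ
  | atom _ => 1
  | and α β => α.size + β.size + 1
  | neg α => α.size + 1
  | fut _ _ _ I A S => (∑ w, (I w).1.size) + (∑ w, (A w).size) + (∑ j, (S j).size) + 1
  | past _ _ _ I A S => (∑ w, (I w).1.size) + (∑ w, (A w).size) + (∑ j, (S j).size) + 1

/-- The largest arity of a modality occurring in the formula (`0` if there is none). -/
def arity : PnEMTL AP → ℕ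
  | atom _ => 0
  | and α β => max α.arity β.arity
  | neg α => α.arity
  | fut k _ _ _ _ S => max k (Finset.univ.sup fun j => (S j).arity)
  | past k _ _ _ _ S => max k (Finset.univ.sup fun j => (S j).arity)

/-- For every future modality occurring in the formula (at any depth), the set of its intervals is
non-adjacent. -/
def FutNonAdjacent : PnEMTL AP → Prop
  | atom _ => True
  | and α β => α.FutNonAdjacent ∧ β.FutNonAdjacent
  | neg α => α.FutNonAdjacent
  | fut _ _ _ I _ S =>
      TimeInterval.NonAdjacent (Set.range fun w => (I w).1) ∧ ∀ j, (S j).FutNonAdjacent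
  | past _ _ _ _ _ S => ∀ j, (S j).FutNonAdjacent

/-- For every past modality occurring in the formula (at any depth), the set of its intervals is
non-adjacent. -/
def PastNonAdjacent : PnEMTL AP → Prop
  | atom _ => True
  | and α β => α.PastNonAdjacent ∧ β.PastNonAdjacent
  | neg α => α.PastNonAdjacent
  | fut _ _ _ _ _ S => ∀ j, (S j).PastNonAdjacent
  | past _ _ _ I _ S =>
      TimeInterval.NonAdjacent (Set.range fun w => (I w).1) ∧ ∀ j, (S j).PastNonAdjacent

/-- Non-adjacent PnEMTL. -/
def NonAdjacent (α : PnEMTL AP) : Prop := α.FutNonAdjacent ∧ α.PastNonAdjacent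

/-- Positively non-adjacent PnEMTL. -/
def PosNonAdjacent (α : PnEMTL AP) : Prop := α.FutNonAdjacent

/-- Negatively non-adjacent PnEMTL. -/
def NegNonAdjacent (α : PnEMTL AP) : Prop := α.PastNonAdjacent

end PnEMTL

/-!
A freeze quantifier `x.θ` at position `i` is translated by guessing, at every position of the word,
which subformulae of `θ` are true there, among them which constraints `T - x ∈ I` are true. Apart
from the constraints, such a labelling can be checked locally, by one automaton that reads the
positions after `i` and one that reads the positions before `i` backwards; they agree on the label
at `i`. See `TPTL.IsCoherent.mem_iff`. Subformulae that do not depend on `x`, namely propositions and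
inner frozen formulae, are the letters read by these automata, and are translated first.

A constraint in the label of a position is a claim that has to be confirmed by the time stamps.
Since intervals are convex and time is monotone, claims that are true at finitely many cut points
are true in between, if between two successive cut points only the claims common to both are made
(`segmentNFA`, `Chain.exists_run`). Two cut points per interval and side suffice, at the first and the
last position where the interval is true (`exists_chain`). The labels at the cut points are guessed
by a disjunction of exponential length, which leaves for each guess one future and one past modality;
the interval of a cut point is the intersection of `[0, ∞)` with the claims made there. The endpoints
of the intersection are `0`, `∞` or endpoints of the given intervals, so non-adjacency is preserved
(`TimeInterval.PosNonAdjacent.nonAdjacent_of_isNatInter`); on the past side all intervals are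
reflected.

The claims are true, but not all true constraints have to be claimed. In negation normal form this is
harmless, because constraints occur positively (`TPTL.IsNNF.robust`). In general, the two components
of the complement of each interval are added as further intervals, and every position has to be
claimed inside, below or above (`TPTL.robust_exact`).

Constraints bound by no quantifier compare the time with the value `0` of `x`, which is the time
stamp of the first position. They are rewritten with quantifiers that bind one half-line each
(`TPTL.close`), because the scopes of half-lines are non-adjacent.
-/

/-! ### Intervals -/

namespace Endpoint

/-- `r` satisfies the bound imposed by `e` as a lower endpoint. -/
def LowerHolds (e : Endpoint) (r : ℝ) : Prop :=
  match e with
  | infinite => True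
  | excluded a => (a : ℝ) < r
  | included a => (a : ℝ) ≤ r

/-- `r` satisfies the bound imposed by `e` as an upper endpoint. -/
def UpperHolds (e : Endpoint) (r : ℝ) : Prop :=
  match e with
  | infinite => True
  | excluded a => r < (a : ℝ)
  | included a => r ≤ (a : ℝ)

theorem LowerHolds.mono {e : Endpoint} {r s : ℝ} (h : e.LowerHolds r) (hrs : r ≤ s) :
    e.LowerHolds s := by
  cases e <;> simp only [LowerHolds] at * <;> linarith

theorem UpperHolds.anti {e : Endpoint} {r s : ℝ} (h : e.UpperHolds s) (hrs : r ≤ s) :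
    e.UpperHolds r := by
  cases e <;> simp only [UpperHolds] at * <;> linarith

theorem size_neg (e : Endpoint) : e.neg.size = e.size := by
  cases e <;> simp [neg, size]

theorem size_pos (e : Endpoint) : 1 ≤ e.size := by
  cases e <;> simp [size]

end Endpoint

namespace TimeInterval

theorem mem_toSet {I : TimeInterval} {r : ℝ} :
    r ∈ I.toSet ↔ I.lower.LowerHolds r ∧ I.upper.UpperHolds r := by
  rcases I with ⟨_ | _ | _, _ | _ | _⟩ <;> rfl

theorem mem_toSet_of_le_of_le {I : TimeInterval} {r s t : ℝ} (hr : r ∈ I.toSet) (ht : t ∈ I.toSet)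
    (hrs : r ≤ s) (hst : s ≤ t) : s ∈ I.toSet := by
  rw [mem_toSet] at *
  exact ⟨hr.1.mono hrs, ht.2.anti hst⟩

theorem mem_toSet_neg {I : TimeInterval} {r : ℝ} : r ∈ I.neg.toSet ↔ -r ∈ I.toSet := by
  rw [mem_toSet, mem_toSet]
  rcases I with ⟨_ | a | a, _ | b | b⟩ <;>
    simp [neg, Endpoint.neg, Endpoint.LowerHolds, Endpoint.UpperHolds, neg_lt, le_neg, lt_neg,
      neg_le, and_comm]

theorem inf_neg (I : TimeInterval) : I.neg.inf = -I.sup := by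
  rcases I with ⟨_ | a | a, _ | b | b⟩ <;> simp [neg, Endpoint.neg, inf, sup]

theorem sup_neg (I : TimeInterval) : I.neg.sup = -I.inf := by
  rcases I with ⟨_ | a | a, _ | b | b⟩ <;> simp [neg, Endpoint.neg, inf, sup]

theorem size_neg (I : TimeInterval) : I.neg.size = I.size := by
  simp [neg, size, Endpoint.size_neg, add_comm]

theorem inf_ne_top (I : TimeInterval) : I.inf ≠ ⊤ := by
  rcases I with ⟨_ | a | a, _ | b | b⟩ <;> simp [inf]

/-- The interval `[0, ∞)`. -/
def nonneg : TimeInterval := ⟨.included 0, .infinite⟩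

theorem isNat_nonneg : nonneg.IsNat := by
  simp [nonneg, IsNat, inf, sup]

theorem PosNonAdjacent.of_nonAdjacent {s : Set TimeInterval} (h : NonAdjacent s) :
    PosNonAdjacent s :=
  fun I hI J hJ => ⟨fun e => ((h I hI J hJ).1 e).le, fun e => ((h I hI J hJ).2 e).le⟩

theorem NegNonAdjacent.of_nonAdjacent {s : Set TimeInterval} (h : NonAdjacent s) :
    NegNonAdjacent s :=
  fun I hI J hJ => ⟨fun e => ((h I hI J hJ).1 e).ge, fun e => ((h I hI J hJ).2 e).ge⟩

theorem NegNonAdjacent.image_neg {s : Set TimeInterval} (h : NegNonAdjacent s) :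
    PosNonAdjacent (neg '' s) := by
  rintro _ ⟨I, hI, rfl⟩ _ ⟨J, hJ, rfl⟩
  simp only [inf_neg, sup_neg, neg_inj, EReal.neg_le, neg_zero]
  exact ⟨(h I hI J hJ).2, (h I hI J hJ).1⟩

/-- `K` is the intersection of `[0, ∞)` with the members of `D`. Its endpoints are `0`, `∞`, or
endpoints of members of `D`, which is why this operation preserves non-adjacency. -/
structure IsNatInter (D : Set TimeInterval) (K : TimeInterval) : Prop where
  isNat : K.IsNat
  mem_iff : ∀ r, 0 ≤ r → (r ∈ K.toSet ↔ ∀ I ∈ D, r ∈ I.toSet)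
  inf_eq : K.inf = 0 ∨ ∃ I ∈ D, K.inf = I.inf
  sup_eq : K.sup = ⊤ ∨ K.sup = 0 ∨ ∃ I ∈ D, K.sup = I.sup

/-- Of two lower endpoints, one is the more restrictive; a restriction of an endpoint in `ℕ` is again
in `ℕ`. -/
theorem _root_.Endpoint.lowerHolds_total {K : TimeInterval} (h : 0 ≤ K.inf) (e : Endpoint) :
    (∀ r, K.lower.LowerHolds r → e.LowerHolds r) ∨
      ((∀ r, e.LowerHolds r → K.lower.LowerHolds r) ∧ 0 ≤ (TimeInterval.mk e K.upper).inf) := by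
  rcases K with ⟨_ | a | a, u⟩
  · simp [inf] at h
  all_goals
    simp only [inf, EReal.coe_nonneg, Int.cast_nonneg_iff] at h
    rcases e with _ | b | b
    · exact Or.inl fun r _ => trivial
    all_goals
      simp only [inf, EReal.coe_nonneg, Int.cast_nonneg_iff, Endpoint.LowerHolds]
      rcases lt_trichotomy a b with hab | hab | hab
      · have : (a : ℝ) < b := by exact_mod_cast hab
        exact Or.inr ⟨fun r hr => by linarith, by lia⟩
      · subst hab
        first
          | exact Or.inl fun r hr => hr
          | exact Or.inl fun r hr => hr.le
          | exact Or.inr ⟨fun r hr => hr.le, h⟩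
      · have : (b : ℝ) < a := by exact_mod_cast hab
        exact Or.inl fun r hr => by linarith

theorem _root_.Endpoint.upperHolds_total (d e : Endpoint) :
    (∀ r, d.UpperHolds r → e.UpperHolds r) ∨ (∀ r, e.UpperHolds r → d.UpperHolds r) := by
  rcases d with _ | a | a
  · exact Or.inr fun r _ => trivial
  all_goals
    rcases e with _ | b | b
    · exact Or.inl fun r _ => trivial
    all_goals
      simp only [Endpoint.UpperHolds]
      rcases lt_trichotomy a b with hab | hab | hab
      · have : (a : ℝ) < b := by exact_mod_cast hab
        exact Or.inl fun r hr => by linarith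
      · subst hab
        first
          | exact Or.inl fun r hr => hr
          | exact Or.inl fun r hr => hr.le
          | exact Or.inr fun r hr => hr.le
      · have : (b : ℝ) < a := by exact_mod_cast hab
        exact Or.inr fun r hr => by linarith

theorem isNatInter_empty : IsNatInter ∅ nonneg where
  isNat := isNat_nonneg
  mem_iff r hr := by simpa [mem_toSet, nonneg, Endpoint.LowerHolds, Endpoint.UpperHolds] using hr
  inf_eq := Or.inl (by simp [nonneg, inf])
  sup_eq := Or.inl rfl

theorem exists_isNatInter {D : Set TimeInterval} (hD : D.Finite) {B : ℕ}
    (hB : ∀ I ∈ D, I.size ≤ B) : ∃ K, IsNatInter D K ∧ K.size ≤ 2 * B + 2 := by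
  suffices h : ∃ K, IsNatInter D K ∧ K.lower.size ≤ B + 1 ∧ K.upper.size ≤ B + 1 by
    obtain ⟨K, hK, h1, h2⟩ := h
    exact ⟨K, hK, by simp only [size]; lia⟩
  induction D, hD using Set.Finite.induction_on with
  | empty => exact ⟨nonneg, isNatInter_empty, by simp [nonneg, Endpoint.size]⟩
  | @insert J D _ _ ih =>
    obtain ⟨K, hK, h1, h2⟩ := ih fun I hI => hB I (Set.mem_insert_of_mem _ hI)
    have hJB : J.lower.size ≤ B + 1 ∧ J.upper.size ≤ B + 1 := by
      have := hB J (Set.mem_insert _ _)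
      simp only [size] at this
      lia
    -- The lower endpoint is the more restrictive one of those of `K` and `J`.
    obtain ⟨l, hl, hl0, hlB, hle⟩ : ∃ l : Endpoint,
        (∀ r, l.LowerHolds r ↔ K.lower.LowerHolds r ∧ J.lower.LowerHolds r) ∧
        (∀ u, 0 ≤ (TimeInterval.mk l u).inf) ∧ l.size ≤ B + 1 ∧
        ∀ u, (TimeInterval.mk l u).inf = K.inf ∨ (TimeInterval.mk l u).inf = J.inf := by
      rcases Endpoint.lowerHolds_total hK.isNat.1 J.lower with h | ⟨h, h0⟩
      · exact ⟨K.lower, fun r => ⟨fun hr => ⟨hr, h r hr⟩, And.left⟩, fun _ => hK.isNat.1, h1,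
          fun _ => Or.inl rfl⟩
      · exact ⟨J.lower, fun r => ⟨fun hr => ⟨h r hr, hr⟩, And.right⟩, fun _ => h0, hJB.1,
          fun _ => Or.inr rfl⟩
    obtain ⟨u, hu, huB, hue⟩ : ∃ u : Endpoint,
        (∀ r, u.UpperHolds r ↔ K.upper.UpperHolds r ∧ J.upper.UpperHolds r) ∧ u.size ≤ B + 1 ∧
        ((TimeInterval.mk l u).sup = K.sup ∨ (TimeInterval.mk l u).sup = J.sup) := by
      rcases Endpoint.upperHolds_total K.upper J.upper with h | h
      · exact ⟨K.upper, fun r => ⟨fun hr => ⟨hr, h r hr⟩, And.left⟩, h2, Or.inl rfl⟩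
      · exact ⟨J.upper, fun r => ⟨fun hr => ⟨h r hr, hr⟩, And.right⟩, hJB.2, Or.inr rfl⟩
    have hmem : ∀ r, 0 ≤ r → ((l.LowerHolds r ∧ u.UpperHolds r) ↔
        ∀ I ∈ insert J D, r ∈ I.toSet) := by
      intro r hr
      rw [Set.forall_mem_insert, ← hK.mem_iff r hr, mem_toSet, mem_toSet, hl, hu]
      tauto
    have hinf : ∀ u, (TimeInterval.mk l u).inf = 0 ∨
        ∃ I ∈ insert J D, (TimeInterval.mk l u).inf = I.inf := by
      intro u
      rcases hle u with h | h
      · rcases hK.inf_eq with h' | ⟨I, hI, h'⟩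
        · exact Or.inl (h.trans h')
        · exact Or.inr ⟨I, Set.mem_insert_of_mem _ hI, h.trans h'⟩
      · exact Or.inr ⟨J, Set.mem_insert _ _, h⟩
    by_cases hs : 0 ≤ (TimeInterval.mk l u).sup
    · refine ⟨⟨l, u⟩, ⟨⟨hl0 _, hs⟩, fun r hr => mem_toSet.trans (hmem r hr), hinf u, ?_⟩, hlB, huB⟩
      rcases hue with h | h
      · rcases hK.sup_eq with h' | h' | ⟨I, hI, h'⟩
        · exact Or.inl (h.trans h')
        · exact Or.inr (Or.inl (h.trans h'))
        · exact Or.inr (Or.inr ⟨I, Set.mem_insert_of_mem _ hI, h.trans h'⟩)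
      · exact Or.inr (Or.inr ⟨J, Set.mem_insert _ _, h⟩)
    · -- A negative upper endpoint leaves no nonnegative real: replace it by an excluded zero.
      refine ⟨⟨l, .excluded 0⟩, ⟨⟨hl0 _, by simp [sup]⟩, fun r hr => ?_, hinf _,
        Or.inr (Or.inl (by simp [sup]))⟩, hlB, by simp [Endpoint.size]⟩
      rw [mem_toSet, ← hmem r hr]
      have h1 : ¬ Endpoint.UpperHolds (.excluded 0) r := by
        simpa [Endpoint.UpperHolds] using hr
      have h2 : ¬ u.UpperHolds r := by
        rcases u with _ | b | b <;> simp [sup, Endpoint.UpperHolds] at hs ⊢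
        all_goals
          have : (b : ℝ) < 0 := by exact_mod_cast hs
          linarith
      simp [h1, h2]

/-- Restricting to `[0, ∞)` leaves only nonnegative endpoints, for which positive non-adjacency is
non-adjacency. -/
theorem PosNonAdjacent.nonAdjacent_of_isNatInter {s t : Set TimeInterval} (hs : PosNonAdjacent s)
    (ht : ∀ K ∈ t, ∃ D ⊆ s, IsNatInter D K) : NonAdjacent t := by
  have key : ∀ K ∈ t, ∀ L ∈ t, K.sup = L.inf → K.sup = 0 := by
    intro K hK L hL h
    obtain ⟨D, hD, hDK⟩ := ht K hK
    obtain ⟨E, hE, hEL⟩ := ht L hL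
    rcases hDK.sup_eq with h1 | h1 | ⟨I, hI, h1⟩
    · exact absurd (h.symm.trans h1) L.inf_ne_top
    · exact h1
    rcases hEL.inf_eq with h2 | ⟨J, hJ, h2⟩
    · exact h.trans h2
    refine le_antisymm ?_ hDK.isNat.2
    rw [h1]
    exact (hs I (hD hI) J (hE hJ)).1 (by rw [← h1, h, h2])
  exact fun K hK L hL => ⟨key K hK L hL, fun h => h.trans (key L hL K hK h.symm)⟩

end TimeInterval

/-! ### Automata and their runs -/

namespace Automaton

variable {m : ℕ} {Q : Type*} [Finite Q]

/-- An automaton with an arbitrary finite type of states, with its states renumbered. -/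
noncomputable def ofNFA (M : NFA (Set (Fin m)) Q) : Automaton m where
  numStates := Nat.card Q
  nfa :=
    { step := fun q b => Finite.equivFin Q '' M.step ((Finite.equivFin Q).symm q) b
      start := Finite.equivFin Q '' M.start
      accept := Finite.equivFin Q '' M.accept }

theorem size_ofNFA_le (M : NFA (Set (Fin m)) Q) :
    (ofNFA M).size ≤ Nat.card Q + Nat.card Q * (2 ^ m * Nat.card Q) := by
  refine Nat.add_le_add_left ((Set.ncard_le_card _).trans ?_) _
  simp [ofNFA]

end Automaton

section Runs

variable {m : ℕ} {Q : Type*}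

theorem segPlus_self {B : Type*} (b : ℕ → B) (x : ℕ) : segPlus b (x + 1) x = [] := by
  simp [segPlus]

theorem segPlus_succ {B : Type*} (b : ℕ → B) {x y : ℕ} (h : x ≤ y) :
    segPlus b (x + 1) (y + 1) = segPlus b (x + 1) y ++ [b (y + 1)] := by
  obtain ⟨n, rfl⟩ := Nat.exists_eq_add_of_le h
  have h1 : x + n + 1 + 1 - (x + 1) = n + 1 := by lia
  have h2 : x + n + 1 - (x + 1) = n := by lia
  simp only [segPlus, h1, h2, List.range'_concat, List.map_append, List.map_cons, List.map_nil]
  congr 3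
  lia

/-- The states reached by the word read at the positions in `(x, y]` are the last states of the
functions `r` that follow the transitions from `x` to `y`; their values elsewhere are irrelevant. -/
theorem NFA.mem_evalFrom_segPlus {B : Type*} (M : NFA B Q) (S : Set Q) (b : ℕ → B) {x y : ℕ}
    (h : x ≤ y) (q : Q) :
    q ∈ M.evalFrom S (segPlus b (x + 1) y) ↔
      ∃ r : ℕ → Q, r x ∈ S ∧ (∀ d, x ≤ d → d < y → r (d + 1) ∈ M.step (r d) (b (d + 1))) ∧
        r y = q := by
  induction y, h using Nat.le_induction generalizing q with
  | base =>
    rw [segPlus_self, NFA.evalFrom_nil]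
    refine ⟨fun hq => ⟨fun _ => q, hq, fun d h1 h2 => by lia, rfl⟩, ?_⟩
    rintro ⟨r, hr, -, rfl⟩
    exact hr
  | succ y hxy ih =>
    rw [segPlus_succ b hxy, NFA.evalFrom_append, NFA.evalFrom_singleton, NFA.mem_stepSet]
    constructor
    · rintro ⟨t, ht, hq⟩
      obtain ⟨r, h1, h2, rfl⟩ := (ih t).1 ht
      refine ⟨fun d => if d ≤ y then r d else q, by simpa [hxy] using h1, fun d hd hd' => ?_,
        by simp⟩
      rcases (Nat.lt_succ_iff.1 hd').lt_or_eq with hlt | rfl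
      · simpa [hlt.le, Nat.succ_le_of_lt hlt] using h2 d hd hlt
      · simpa using hq
    · rintro ⟨r, h1, h2, rfl⟩
      exact ⟨r y, (ih _).2 ⟨r, h1, fun d hd hd' => h2 d hd (by lia), rfl⟩, h2 y hxy (by lia)⟩

/-- An automaton accepts the word read at the positions in `(x, y]` if and only if it has a run that
visits a state at each position in `[x, y]`. -/
theorem Automaton.segPlus_mem_accepts_ofNFA [Finite Q] (M : NFA (Set (Fin m)) Q)
    (b : ℕ → Set (Fin m)) {x y : ℕ} (h : x ≤ y) :
    segPlus b (x + 1) y ∈ (Automaton.ofNFA M).nfa.accepts ↔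
      ∃ r : ℕ → Q, r x ∈ M.start ∧ (∀ d, x ≤ d → d < y → r (d + 1) ∈ M.step (r d) (b (d + 1))) ∧
        r y ∈ M.accept := by
  rw [NFA.mem_accepts]
  simp only [NFA.mem_evalFrom_segPlus _ _ b h]
  constructor
  · rintro ⟨_, hs, r, h1, h2, rfl⟩
    refine ⟨fun d => (Finite.equivFin Q).symm (r d), ?_, fun d hd hd' => ?_, ?_⟩
    · obtain ⟨q, hq, e⟩ := h1
      simpa [← e] using hq
    · obtain ⟨q, hq, e⟩ := h2 d hd hd'
      simpa [← e] using hq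
    · obtain ⟨q, hq, e⟩ := hs
      simpa [← e] using hq
  · rintro ⟨r, h1, h2, h3⟩
    refine ⟨_, ⟨_, h3, rfl⟩, fun d => Finite.equivFin Q (r d), ⟨_, h1, rfl⟩, fun d hd hd' => ?_, rfl⟩
    exact ⟨r (d + 1), by simpa using h2 d hd hd', rfl⟩

/-- Runs over consecutive stretches that agree at the cut points glue to one run. -/
theorem exists_glued_run {G : ℕ → Q → Q → Prop} {k : ℕ} {p : Fin (k + 1) → ℕ} (hp : Monotone p)
    (s : Fin (k + 1) → Q)
    (h : ∀ w : Fin k, ∃ r : ℕ → Q, r (p w.castSucc) = s w.castSucc ∧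
      (∀ d, p w.castSucc ≤ d → d < p w.succ → G d (r d) (r (d + 1))) ∧
      r (p w.succ) = s w.succ) (w : Fin (k + 1)) :
    ∃ r : ℕ → Q, r (p 0) = s 0 ∧ (∀ d, p 0 ≤ d → d < p w → G d (r d) (r (d + 1))) ∧
      r (p w) = s w := by
  induction w using Fin.induction with
  | zero => exact ⟨fun _ => s 0, rfl, fun d h1 h2 => by lia, rfl⟩
  | succ w ih =>
    obtain ⟨r, h1, h2, h3⟩ := ih
    obtain ⟨r', h1', h2', h3'⟩ := h w
    have h0 : p 0 ≤ p w.castSucc := hp (Fin.zero_le _)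
    have hw : p w.castSucc ≤ p w.succ := hp (Fin.castSucc_lt_succ).le
    refine ⟨fun d => if d ≤ p w.castSucc then r d else r' d, by simpa [h0] using h1,
      fun d hd hd' => ?_, ?_⟩
    · rcases lt_trichotomy d (p w.castSucc) with hlt | rfl | hgt
      · simpa [hlt.le, Nat.succ_le_of_lt hlt] using h2 d hd hlt
      · simpa [h3, ← h1'] using h2' _ le_rfl hd'
      · have h4 : ¬ d ≤ p w.castSucc := by lia
        have h5 : ¬ d + 1 ≤ p w.castSucc := by lia
        simpa [h4, h5] using h2' d hgt.le hd'
    · rcases hw.lt_or_eq with hlt | heq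
      · simpa [not_le.2 hlt] using h3'
      · simp only [← heq, le_refl, if_true, h3, ← h1', ← h3']

end Runs

/-! ### Timed runs and chains of automata -/

/-- The content of both modalities of PnEMTL, with positions numbered by their distance from the
current one: there are `L` further positions, the one at distance `d` is `δ d` time units away and
carries the letter `b d`. -/
def Chain {m : ℕ} (L : ℕ) (δ : ℕ → ℝ) (b : ℕ → Set (Fin m)) (k : ℕ) (I : Fin k → TimeInterval)
    (A : Fin (k + 1) → Automaton m) : Prop :=
  ∃ p : Fin (k + 1) → ℕ, p 0 = 0 ∧ Monotone p ∧ p (Fin.last k) ≤ L ∧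
    (∀ w : Fin k, δ (p w.succ) ∈ (I w).toSet ∧
      segPlus b (p w.castSucc + 1) (p w.succ) ∈ (A w.castSucc).nfa.accepts) ∧
    segPlus b (p (Fin.last k) + 1) L ∈ (A (Fin.last k)).nfa.accepts

/-- Finitely many cut points that include the first and the last element of each `T ι` in
`{0, …, L}`. -/
theorem exists_cut_points {ι : Type*} (J : Finset ι) (T : ι → Set ℕ) (L k : ℕ)
    (hk : 2 * J.card ≤ k) :
    ∃ p : Fin (k + 1) → ℕ, p 0 = 0 ∧ Monotone p ∧ p (Fin.last k) ≤ L ∧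
      (∀ d ≤ L, p (Fin.last k) < d → ∀ i ∈ J, d ∉ T i) ∧
      ∀ (w : Fin k) (d : ℕ), p w.castSucc < d → d < p w.succ → ∀ i ∈ J, d ∈ T i →
        (∃ x ∈ T i, x ≤ p w.castSucc) ∧ ∃ y ∈ T i, p w.succ ≤ y ∧ y ≤ L := by
  classical
  set U : ι → Finset ℕ := fun i => (Finset.range (L + 1)).filter (· ∈ T i) with hU
  have hUmem : ∀ i d, d ∈ U i ↔ d ≤ L ∧ d ∈ T i := by simp [hU]
  set P : Finset ℕ := insert 0
    (J.image (fun i => (U i).min.getD 0) ∪ J.image (fun i => (U i).max.getD 0)) with hP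
  have hne : P.Nonempty := ⟨0, by simp [hP]⟩
  have hcard : P.card ≤ k + 1 := by
    refine (Finset.card_insert_le _ _).trans (Nat.succ_le_succ ?_)
    refine (Finset.card_union_le _ _).trans ?_
    have h1 := Finset.card_image_le (s := J) (f := fun i => (U i).min.getD 0)
    have h2 := Finset.card_image_le (s := J) (f := fun i => (U i).max.getD 0)
    lia
  have hpos : 0 < P.card := hne.card_pos
  set e := P.orderEmbOfFin rfl with he
  set p : Fin (k + 1) → ℕ := fun w => e ⟨min w (P.card - 1), by lia⟩ with hp
  have hmono : Monotone p := fun v w hvw => e.monotone (by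
    rw [Fin.mk_le_mk]
    exact min_le_min_right _ hvw)
  have hsurj : ∀ x ∈ P, ∃ w, p w = x := by
    intro x hx
    obtain ⟨v, rfl⟩ : x ∈ Set.range e := by rw [he, Finset.range_orderEmbOfFin]; exact hx
    refine ⟨⟨v, by lia⟩, congrArg e (Fin.ext ?_)⟩
    have := v.2
    simp only
    lia
  have hPL : ∀ x ∈ P, x ≤ L := by
    intro x hx
    simp only [hP, Finset.mem_insert, Finset.mem_union, Finset.mem_image] at hx
    rcases hx with rfl | ⟨i, -, rfl⟩ | ⟨i, -, rfl⟩
    · exact Nat.zero_le _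
    · cases h : (U i).min with
      | top => exact Nat.zero_le _
      | coe a => exact ((hUmem _ _).1 (Finset.mem_of_min h)).1
    · cases h : (U i).max with
      | bot => exact Nat.zero_le _
      | coe a => exact ((hUmem _ _).1 (Finset.mem_of_max h)).1
  have hpP : ∀ w, p w ∈ P := fun w => Finset.orderEmbOfFin_mem _ _ _
  have hfirst : ∀ i ∈ J, ∀ d ≤ L, d ∈ T i → ∃ w, p w ∈ T i ∧ p w ≤ d := by
    intro i hi d hd hdT
    obtain ⟨a, ha⟩ := Finset.min_of_mem ((hUmem i d).2 ⟨hd, hdT⟩)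
    obtain ⟨w, hw⟩ := hsurj a (by
      simp only [hP, Finset.mem_insert, Finset.mem_union, Finset.mem_image]
      exact Or.inr (Or.inl ⟨i, hi, by rw [ha]; rfl⟩))
    exact ⟨w, hw ▸ ((hUmem _ _).1 (Finset.mem_of_min ha)).2,
      hw ▸ Finset.min_le_of_eq ((hUmem i d).2 ⟨hd, hdT⟩) ha⟩
  have hlast : ∀ i ∈ J, ∀ d ≤ L, d ∈ T i → ∃ w, p w ∈ T i ∧ d ≤ p w := by
    intro i hi d hd hdT
    obtain ⟨a, ha⟩ := Finset.max_of_mem ((hUmem i d).2 ⟨hd, hdT⟩)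
    obtain ⟨w, hw⟩ := hsurj a (by
      simp only [hP, Finset.mem_insert, Finset.mem_union, Finset.mem_image]
      exact Or.inr (Or.inr ⟨i, hi, by rw [ha]; rfl⟩))
    exact ⟨w, hw ▸ ((hUmem _ _).1 (Finset.mem_of_max ha)).2,
      hw ▸ Finset.le_max_of_eq ((hUmem i d).2 ⟨hd, hdT⟩) ha⟩
  refine ⟨p, ?_, hmono, hPL _ (hpP _), ?_, ?_⟩
  · obtain ⟨w, hw⟩ := hsurj 0 (by simp [hP])
    exact Nat.le_zero.1 ((hmono (Fin.zero_le w)).trans hw.le)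
  · intro d hd hlt i hi hdT
    obtain ⟨w, -, hw⟩ := hlast i hi d hd hdT
    have := hmono (Fin.le_last w)
    lia
  · intro w d h1 h2 i hi hdT
    have hdL : d ≤ L := h2.le.trans (hPL _ (hpP _))
    obtain ⟨v, hvT, hv⟩ := hfirst i hi d hdL hdT
    obtain ⟨u, huT, hu⟩ := hlast i hi d hdL hdT
    refine ⟨⟨_, hvT, hmono ?_⟩, _, huT, hmono ?_, hPL _ (hpP _)⟩
    · by_contra hlt
      have := hmono (Fin.castSucc_lt_iff_succ_le.1 (not_le.1 hlt))
      lia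
    · by_contra hlt
      have := hmono (Fin.le_castSucc_iff.2 (not_le.1 hlt))
      lia

section TimedRuns

variable {m : ℕ} {Q : Type*} [Finite Q]

/-- The automaton for the stretch between two consecutive cut points, at which the states are `s`
and `t`: it simulates the step relation `R`, and strictly between the cut points it visits only
states whose claims `cl` are claims of both `s` and `t`. -/
def segmentNFA (R : Q → Set (Fin m) → Q → Prop) (cl : Q → Set TimeInterval) (s t : Q) :
    NFA (Set (Fin m)) Q where
  step q b := {q' | R q b q' ∧ (cl q' ⊆ cl s ∩ cl t ∨ q' = t) ∧ (cl q ⊆ cl s ∩ cl t ∨ q = s)}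
  start := {s}
  accept := {t}

/-- The automaton for the stretch after the last cut point, where the state is `s`: no claim is made
there. -/
def tailNFA (R : Q → Set (Fin m) → Q → Prop) (cl : Q → Set TimeInterval) (F : Set Q) (s : Q) :
    NFA (Set (Fin m)) Q where
  step q b := {q' | R q b q' ∧ cl q' = ∅}
  start := {s}
  accept := F

/-- The automata of the chain whose states at the cut points are `s`. -/
noncomputable def chainAutomata (R : Q → Set (Fin m) → Q → Prop) (cl : Q → Set TimeInterval)
    (F : Set Q) {k : ℕ} (s : Fin (k + 1) → Q) : Fin (k + 1) → Automaton m :=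
  Fin.lastCases (Automaton.ofNFA (tailNFA R cl F (s (Fin.last k))))
    fun w => Automaton.ofNFA (segmentNFA R cl (s w.castSucc) (s w.succ))

theorem size_chainAutomata_le (R : Q → Set (Fin m) → Q → Prop) (cl : Q → Set TimeInterval)
    (F : Set Q) {k : ℕ} (s : Fin (k + 1) → Q) (w : Fin (k + 1)) :
    (chainAutomata R cl F s w).size ≤ Nat.card Q + Nat.card Q * (2 ^ m * Nat.card Q) := by
  cases w using Fin.lastCases <;> simp only [chainAutomata, Fin.lastCases_last,
    Fin.lastCases_castSucc] <;> exact Automaton.size_ofNFA_le _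

variable {R : Q → Set (Fin m) → Q → Prop} {cl : Q → Set TimeInterval} {F : Set Q} {k L : ℕ}
  {δ : ℕ → ℝ} {b : ℕ → Set (Fin m)} {I : Fin k → TimeInterval} {s : Fin (k + 1) → Q}

/-- By convexity of intervals, the claims of a chain are true everywhere once they are true at the
cut points. -/
theorem Chain.exists_run (hδ0 : δ 0 = 0) (hδ : ∀ d e, d ≤ e → e ≤ L → δ d ≤ δ e)
    (hI : ∀ w : Fin k, TimeInterval.IsNatInter (cl (s w.succ)) (I w))
    (hs0 : ∀ J ∈ cl (s 0), 0 ∈ J.toSet) (h : Chain L δ b k I (chainAutomata R cl F s)) :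
    ∃ r : ℕ → Q, r 0 = s 0 ∧ (∀ d < L, R (r d) (b (d + 1)) (r (d + 1))) ∧ r L ∈ F ∧
      ∀ d ≤ L, ∀ J ∈ cl (r d), δ d ∈ J.toSet := by
  obtain ⟨p, hp0, hp, hpL, hseg, htail⟩ := h
  have hpL' : ∀ w, p w ≤ L := fun w => (hp (Fin.le_last w)).trans hpL
  have hcut : ∀ w, ∀ J ∈ cl (s w), δ (p w) ∈ J.toSet := by
    intro w
    cases w using Fin.cases with
    | zero => rwa [hp0, hδ0]
    | succ w =>
      exact ((hI w).mem_iff _ (hδ0 ▸ hδ 0 _ (Nat.zero_le _) (hpL' _))).1 (hseg w).1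
  set G : ℕ → Q → Q → Prop := fun d q q' =>
    R q (b (d + 1)) q' ∧ ∀ J ∈ cl q', δ (d + 1) ∈ J.toSet with hG
  have hrun : ∀ w : Fin k, ∃ r : ℕ → Q, r (p w.castSucc) = s w.castSucc ∧
      (∀ d, p w.castSucc ≤ d → d < p w.succ → G d (r d) (r (d + 1))) ∧
      r (p w.succ) = s w.succ := by
    intro w
    have hw : p w.castSucc ≤ p w.succ := hp (Fin.castSucc_lt_succ).le
    have hacc := (hseg w).2
    rw [chainAutomata, Fin.lastCases_castSucc, Automaton.segPlus_mem_accepts_ofNFA _ _ hw] at hacc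
    obtain ⟨r, h1, h2, h3⟩ := hacc
    refine ⟨r, h1, fun d hd hd' => ⟨(h2 d hd hd').1, ?_⟩, h3⟩
    rcases (Nat.succ_le_of_lt hd').lt_or_eq with hlt | heq
    · -- `d + 1` lies strictly between the cut points; it is entered and left by a step.
      have hsub : cl (r (d + 1)) ⊆ cl (s w.castSucc) ∩ cl (s w.succ) := by
        rcases (h2 d hd hd').2.1 with h4 | h4
        · exact h4
        rcases (h2 (d + 1) (by lia) hlt).2.2 with h5 | h5
        · exact h5
        · rw [← h4, ← h5, Set.inter_self]
      intro J hJ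
      exact TimeInterval.mem_toSet_of_le_of_le (hcut _ J (hsub hJ).1) (hcut _ J (hsub hJ).2)
        (hδ _ _ (by lia) (by have := hpL' w.succ; lia)) (hδ _ _ hlt.le (hpL' _))
    · have h3' : r (p w.succ) = s w.succ := h3
      rw [Nat.succ_eq_add_one] at heq
      rw [heq, h3']
      exact hcut _
  obtain ⟨r, h1, h2, h3⟩ := exists_glued_run hp s hrun (Fin.last k)
  rw [chainAutomata, Fin.lastCases_last, Automaton.segPlus_mem_accepts_ofNFA _ _ hpL] at htail
  obtain ⟨r', h1', h2', h3'⟩ := htail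
  -- The cut points `0`, the last cut point and `L` delimit the two runs to be glued.
  obtain ⟨r'', g1, g2, g3⟩ := exists_glued_run (G := G) (p := ![0, p (Fin.last k), L])
    (Fin.monotone_iff_le_succ.2 (by
      intro i
      fin_cases i
      · exact Nat.zero_le _
      · exact hpL)) ![s 0, s (Fin.last k), r' L] (by
      intro w
      fin_cases w
      · exact ⟨r, by simpa [hp0] using h1, by simpa [hp0] using h2, h3⟩
      · refine ⟨r', h1', fun d hd hd' => ⟨(h2' d hd hd').1, ?_⟩, rfl⟩
        have : cl (r' (d + 1)) = ∅ := (h2' d hd hd').2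
        simp [this]) (Fin.last 2)
  refine ⟨r'', g1, fun d hd => (g2 d (Nat.zero_le _) hd).1, ?_, fun d hd => ?_⟩
  · have : r'' L = r' L := g3
    rw [this]
    exact h3'
  · rcases d with _ | d
    · have : r'' 0 = s 0 := g1
      rw [this, hδ0]
      exact hs0
    · exact (g2 d (Nat.zero_le _) (by simpa using hd)).2

/-- A run whose claims are exactly the true members of `J` gives a chain, with cut points at the first
and the last position at which each member of `J` is true. -/
theorem exists_chain (hδ0 : δ 0 = 0) (hδ : ∀ d e, d ≤ e → e ≤ L → δ d ≤ δ e)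
    {K : Set TimeInterval → TimeInterval} (hK : ∀ q, TimeInterval.IsNatInter (cl q) (K (cl q)))
    (J : Finset TimeInterval) (hk : 2 * J.card ≤ k) {r : ℕ → Q}
    (hr : ∀ d < L, R (r d) (b (d + 1)) (r (d + 1))) (hF : r L ∈ F)
    (hcl : ∀ d ≤ L, cl (r d) = {I | I ∈ J ∧ δ d ∈ I.toSet}) :
    ∃ s : Fin (k + 1) → Q, s 0 = r 0 ∧
      Chain L δ b k (fun w => K (cl (s w.succ))) (chainAutomata R cl F s) := by
  obtain ⟨p, hp0, hp, hpL, hlast, hcut⟩ := exists_cut_points J (fun I => {d | δ d ∈ I.toSet}) L k hk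
  have hpL' : ∀ w, p w ≤ L := fun w => (hp (Fin.le_last w)).trans hpL
  refine ⟨fun w => r (p w), by simp [hp0], p, hp0, hp, hpL, fun w => ⟨?_, ?_⟩, ?_⟩
  · rw [(hK _).mem_iff _ (hδ0 ▸ hδ 0 _ (Nat.zero_le _) (hpL' _)), hcl _ (hpL' _)]
    exact fun I hI => hI.2
  · have hw : p w.castSucc ≤ p w.succ := hp (Fin.castSucc_lt_succ).le
    rw [chainAutomata, Fin.lastCases_castSucc, Automaton.segPlus_mem_accepts_ofNFA _ _ hw]
    have hin : ∀ d, p w.castSucc < d → d < p w.succ →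
        cl (r d) ⊆ cl (r (p w.castSucc)) ∩ cl (r (p w.succ)) := by
      intro d hd hd' I hI
      have hdL := hpL' w.succ
      rw [hcl _ (by lia)] at hI
      obtain ⟨⟨x, hxT, hx⟩, y, hyT, hy, hyL⟩ := hcut w d hd hd' I hI.1 hI.2
      rw [hcl _ (hpL' _), hcl _ (hpL' _)]
      exact ⟨⟨hI.1, TimeInterval.mem_toSet_of_le_of_le hxT hI.2 (hδ _ _ hx (hpL' _))
        (hδ _ _ hd.le (by lia))⟩, hI.1, TimeInterval.mem_toSet_of_le_of_le hI.2 hyT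
        (hδ _ _ hd'.le (hpL' _)) (hδ _ _ hy hyL)⟩
    refine ⟨r, rfl, fun d hd hd' => ⟨hr d (by have := hpL' w.succ; lia), ?_, ?_⟩, rfl⟩
    · rcases (Nat.succ_le_of_lt hd').lt_or_eq with hlt | heq
      · exact Or.inl (hin _ (by lia) hlt)
      · exact Or.inr (congrArg r heq)
    · rcases hd.lt_or_eq with hlt | heq
      · exact Or.inl (hin _ hlt hd')
      · exact Or.inr (congrArg r heq.symm)
  · rw [chainAutomata, Fin.lastCases_last, Automaton.segPlus_mem_accepts_ofNFA _ _ hpL]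
    refine ⟨r, rfl, fun d hd hd' => ⟨hr d hd', ?_⟩, hF⟩
    rw [hcl _ (by lia)]
    exact Set.eq_empty_of_forall_notMem fun I hI => hlast _ (by lia) (by lia) I hI.1 hI.2

end TimedRuns

/-! ### Boolean combinations and modalities of PnEMTL -/

namespace PnEMTL

variable {AP : Type*}

/-- A formula that holds nowhere: a modality whose automata have no states. -/
def bot : PnEMTL AP :=
  fut 1 0 le_rfl (fun _ => ⟨TimeInterval.nonneg, TimeInterval.isNat_nonneg⟩)
    (fun _ => ⟨0, ⟨fun _ _ => ∅, ∅, ∅⟩⟩) Fin.elim0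

/-- The conjunction of a list of formulae. -/
def conj (l : List (PnEMTL AP)) : PnEMTL AP := l.foldr and (neg bot)

/-- The disjunction of a list of formulae. -/
def disj (l : List (PnEMTL AP)) : PnEMTL AP := neg (conj (l.map neg))

theorem not_sat_bot (ρ : TimedWord AP) (i : ℕ) : ¬ bot.Sat ρ i := by
  rintro ⟨p, -, -, -, -, h⟩
  obtain ⟨q, -, -⟩ := NFA.mem_accepts.1 h
  exact q.elim0

theorem sat_conj {ρ : TimedWord AP} {l : List (PnEMTL AP)} {i : ℕ} :
    (conj l).Sat ρ i ↔ ∀ β ∈ l, β.Sat ρ i := by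
  induction l with
  | nil => simpa [conj, Sat] using not_sat_bot ρ i
  | cons β l ih =>
    change β.Sat ρ i ∧ (conj l).Sat ρ i ↔ _
    simp [ih]

theorem sat_disj {ρ : TimedWord AP} {l : List (PnEMTL AP)} {i : ℕ} :
    (disj l).Sat ρ i ↔ ∃ β ∈ l, β.Sat ρ i := by
  simp [disj, Sat, sat_conj]

theorem size_bot : (bot : PnEMTL AP).size = 3 := by
  simp [bot, size, Automaton.size, TimeInterval.nonneg, TimeInterval.size, Endpoint.size]

theorem size_conj_le {l : List (PnEMTL AP)} {X : ℕ} (h : ∀ β ∈ l, β.size ≤ X) :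
    (conj l).size ≤ l.length * (X + 1) + 4 := by
  induction l with
  | nil => simp [conj, size, size_bot]
  | cons β l ih =>
    have h1 := ih fun γ hγ => h γ (List.mem_cons_of_mem _ hγ)
    have h2 := h β List.mem_cons_self
    change β.size + (conj l).size + 1 ≤ _
    rw [List.length_cons, Nat.succ_mul]
    lia

theorem size_disj_le {l : List (PnEMTL AP)} {X : ℕ} (h : ∀ β ∈ l, β.size ≤ X) :
    (disj l).size ≤ l.length * (X + 2) + 5 := by
  have := size_conj_le (l := l.map neg) (X := X + 1) (by
    intro β hβ
    obtain ⟨γ, hγ, rfl⟩ := List.mem_map.1 hβ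
    exact Nat.succ_le_succ (h γ hγ))
  rw [List.length_map] at this
  exact Nat.succ_le_succ this

theorem arity_conj_le {l : List (PnEMTL AP)} {X : ℕ} (hX : 1 ≤ X) (h : ∀ β ∈ l, β.arity ≤ X) :
    (conj l).arity ≤ X := by
  induction l with
  | nil => simpa [conj, arity, bot] using hX
  | cons β l ih =>
    exact max_le (h β List.mem_cons_self) (ih fun γ hγ => h γ (List.mem_cons_of_mem _ hγ))

theorem arity_disj_le {l : List (PnEMTL AP)} {X : ℕ} (hX : 1 ≤ X) (h : ∀ β ∈ l, β.arity ≤ X) :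
    (disj l).arity ≤ X :=
  arity_conj_le hX (by simpa [arity] using h)

theorem futNonAdjacent_bot : (bot : PnEMTL AP).FutNonAdjacent := by
  refine ⟨?_, fun j => j.elim0⟩
  rintro _ ⟨-, rfl⟩ _ ⟨-, rfl⟩
  simp [TimeInterval.nonneg, TimeInterval.inf, TimeInterval.sup]

theorem futNonAdjacent_conj {l : List (PnEMTL AP)} (h : ∀ β ∈ l, β.FutNonAdjacent) :
    (conj l).FutNonAdjacent := by
  induction l with
  | nil => exact futNonAdjacent_bot
  | cons β l ih =>
    exact ⟨h β List.mem_cons_self, ih fun γ hγ => h γ (List.mem_cons_of_mem _ hγ)⟩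

theorem futNonAdjacent_disj {l : List (PnEMTL AP)} (h : ∀ β ∈ l, β.FutNonAdjacent) :
    (disj l).FutNonAdjacent :=
  futNonAdjacent_conj (by simpa [FutNonAdjacent] using h)

theorem pastNonAdjacent_conj {l : List (PnEMTL AP)} (h : ∀ β ∈ l, β.PastNonAdjacent) :
    (conj l).PastNonAdjacent := by
  induction l with
  | nil => exact fun j => j.elim0
  | cons β l ih =>
    exact ⟨h β List.mem_cons_self, ih fun γ hγ => h γ (List.mem_cons_of_mem _ hγ)⟩

theorem pastNonAdjacent_disj {l : List (PnEMTL AP)} (h : ∀ β ∈ l, β.PastNonAdjacent) :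
    (disj l).PastNonAdjacent :=
  pastNonAdjacent_conj (by simpa [PastNonAdjacent] using h)

end PnEMTL

theorem segPlus_add {B : Type*} (b : ℕ → B) (i x y : ℕ) :
    segPlus b (i + x + 1) (i + y) = segPlus (fun d => b (i + d)) (x + 1) y := by
  refine List.ext_getElem (by simp [segPlus]; lia) fun n h1 h2 => ?_
  simp only [segPlus, List.getElem_map, List.getElem_range']
  congr 1
  lia

/-- Without `x < i` the truncated subtraction `i - x - 1` would add a letter at position `0`. -/
theorem segMinus_sub {B : Type*} (b : ℕ → B) {i x y : ℕ} (hx : x < i) (hy : y ≤ i) :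
    segMinus b (i - x - 1) (i - y) = segPlus (fun d => b (i - d)) (x + 1) y := by
  refine List.ext_getElem (by simp [segMinus, segPlus]; lia) fun n h1 h2 => ?_
  simp only [segPlus, List.length_map, List.length_range'] at h2
  simp only [segMinus, segPlus, List.getElem_reverse, List.getElem_map, List.getElem_range',
    List.length_map, List.length_range']
  congr 1
  lia

namespace PnEMTL

variable {AP : Type*} {ρ : TimedWord AP} {i k m : ℕ} {hk : 1 ≤ k}
  {I : Fin k → {I : TimeInterval // I.IsNat}} {A : Fin (k + 1) → Automaton m}
  {S : Fin m → PnEMTL AP}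

theorem sat_fut_iff_chain (hi : i ∈ ρ.dom) :
    (fut k m hk I A S).Sat ρ i ↔
      Chain (ρ.len - i) (fun d => ρ.time (i + d) - ρ.time i)
        (fun d => {j | (S j).Sat ρ (i + d)}) k (fun w => (I w).1) A := by
  have hL : i + (ρ.len - i) = ρ.len := Nat.add_sub_cancel' hi.2
  constructor
  · rintro ⟨p, hp0, hp, hpL, hseg, htail⟩
    have hip : ∀ w, i + (p w - i) = p w := fun w => by
      have := hp (Fin.zero_le w)
      lia
    refine ⟨fun w => p w - i, by simp [hp0], fun v w hvw => Nat.sub_le_sub_right (hp hvw) i,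
      Nat.sub_le_sub_right hpL i, fun w => ⟨?_, ?_⟩, ?_⟩
    · simpa only [hip] using (hseg w).1
    · rw [← segPlus_add (fun z => {j : Fin m | (S j).Sat ρ z}), hip, hip]
      exact (hseg w).2
    · rw [← segPlus_add (fun z => {j : Fin m | (S j).Sat ρ z}), hip, hL]
      exact htail
  · rintro ⟨p, hp0, hp, hpL, hseg, htail⟩
    refine ⟨fun w => i + p w, by simp [hp0], fun v w hvw => Nat.add_le_add_left (hp hvw) i,
      by lia, fun w => ⟨(hseg w).1, ?_⟩, ?_⟩
    · rw [segPlus_add]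
      exact (hseg w).2
    · rw [← hL, segPlus_add]
      exact htail

theorem sat_past_iff_chain (hi : i ∈ ρ.dom) :
    (past k m hk I A S).Sat ρ i ↔
      Chain (i - 1) (fun d => ρ.time i - ρ.time (i - d))
        (fun d => {j | (S j).Sat ρ (i - d)}) k (fun w => (I w).1) A := by
  have hi1 : 1 ≤ i := hi.1
  have hL : i - (i - 1) = 1 := by lia
  constructor
  · rintro ⟨p, hp0, hp, hpL, hseg, htail⟩
    have hpi : ∀ w, p w ≤ i := fun w => hp0 ▸ hp (Fin.zero_le w)
    have hlt : ∀ w, i - p w < i := fun w => by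
      have := hp (Fin.le_last w)
      lia
    have hip : ∀ w, i - (i - p w) = p w := fun w => by
      have := hpi w
      lia
    refine ⟨fun w => i - p w, by simp [hp0], fun v w hvw => Nat.sub_le_sub_left (hp hvw) i,
      Nat.sub_le_sub_left hpL i, fun w => ⟨?_, ?_⟩, ?_⟩
    · simpa only [hip] using (hseg w).1
    · rw [← segMinus_sub (fun z => {j : Fin m | (S j).Sat ρ z}) (hlt _) (Nat.sub_le _ _), hip, hip]
      exact (hseg w).2
    · rw [← segMinus_sub (fun z => {j : Fin m | (S j).Sat ρ z}) (hlt _) (Nat.sub_le _ _), hip, hL]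
      exact htail
  · rintro ⟨p, hp0, hp, hpL, hseg, htail⟩
    have hpi : ∀ w, p w < i := fun w => by
      have := hp (Fin.le_last w)
      lia
    refine ⟨fun w => i - p w, by simp [hp0], fun v w hvw => Nat.sub_le_sub_left (hp hvw) i,
      by lia, fun w => ⟨(hseg w).1, ?_⟩, ?_⟩
    · rw [segMinus_sub _ (hpi _) (hpi _).le]
      exact (hseg w).2
    · rw [← segMinus_sub (fun z => {j : Fin m | (S j).Sat ρ z}) (hpi _) (Nat.sub_le _ _),
        hL] at htail
      exact htail

end PnEMTL

/-! ### Subformulae and claimed constraints -/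

namespace TPTL

variable {AP : Type*}

/-- The subformulae outside the scope of inner freeze quantifiers. -/
def sub : TPTL AP → Set (TPTL AP)
  | atom a => {atom a}
  | tt => {tt}
  | ff => {ff}
  | neg φ => insert (neg φ) φ.sub
  | and φ ψ => insert (and φ ψ) (φ.sub ∪ ψ.sub)
  | or φ ψ => insert (or φ ψ) (φ.sub ∪ ψ.sub)
  | untl φ ψ => insert (untl φ ψ) (φ.sub ∪ ψ.sub)
  | snce φ ψ => insert (snce φ ψ) (φ.sub ∪ ψ.sub)
  | box φ => insert (box φ) φ.sub
  | boxPast φ => insert (boxPast φ) φ.sub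
  | freeze φ => {freeze φ}
  | ctr I => {ctr I}

/-- Propositions and frozen formulae: their truth does not depend on the freeze variable, and they
become the arguments of modalities. -/
def IsLeaf : TPTL AP → Prop
  | atom _ => True
  | freeze _ => True
  | _ => False

theorem self_mem_sub (φ : TPTL AP) : φ ∈ φ.sub := by
  cases φ <;> simp [sub]

theorem finite_sub (φ : TPTL AP) : φ.sub.Finite := by
  induction φ <;> simp_all [sub]

theorem ncard_sub_le (φ : TPTL AP) : φ.sub.ncard ≤ φ.size := by
  induction φ with
  | atom | tt | ff | freeze | ctr => simp [sub, size]
  | neg φ ih | box φ ih | boxPast φ ih => exact (Set.ncard_insert_le _ _).trans (Nat.succ_le_succ ih)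
  | and φ ψ ih1 ih2 | or φ ψ ih1 ih2 | untl φ ψ ih1 ih2 | snce φ ψ ih1 ih2 =>
    exact (Set.ncard_insert_le _ _).trans
      (Nat.succ_le_succ ((Set.ncard_union_le _ _).trans (Nat.add_le_add ih1 ih2)))

theorem sub_subset {φ χ : TPTL AP} (h : χ ∈ φ.sub) : χ.sub ⊆ φ.sub := by
  induction φ with
  | atom | tt | ff | freeze | ctr =>
    rw [Set.mem_singleton_iff.1 h]
  | neg φ ih | box φ ih | boxPast φ ih =>
    rcases h with rfl | h
    · exact subset_rfl
    · exact (ih h).trans (Set.subset_insert _ _)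
  | and φ ψ ih1 ih2 | or φ ψ ih1 ih2 | untl φ ψ ih1 ih2 | snce φ ψ ih1 ih2 =>
    rcases h with rfl | h | h
    · exact subset_rfl
    · exact (ih1 h).trans (Set.subset_union_left.trans (Set.subset_insert _ _))
    · exact (ih2 h).trans (Set.subset_union_right.trans (Set.subset_insert _ _))

theorem mem_of_sub {φ χ θ : TPTL AP} (h : φ ∈ θ.sub) (hχ : χ ∈ φ.sub) : χ ∈ θ.sub := sub_subset h hχ

theorem mem_scopeIntervals {φ : TPTL AP} {I : TimeInterval} :
    I ∈ φ.scopeIntervals ↔ ctr I ∈ φ.sub := by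
  induction φ <;> simp_all [sub, scopeIntervals]

theorem finite_scopeIntervals (φ : TPTL AP) : φ.scopeIntervals.Finite := by
  induction φ <;> simp_all [scopeIntervals]

theorem scopeIntervals_subset (φ : TPTL AP) : φ.scopeIntervals ⊆ φ.intervals := by
  induction φ with
  | atom | tt | ff | freeze | ctr => simp [scopeIntervals, intervals]
  | neg φ ih | box φ ih | boxPast φ ih => exact ih
  | and φ ψ ih1 ih2 | or φ ψ ih1 ih2 | untl φ ψ ih1 ih2 | snce φ ψ ih1 ih2 =>
    exact Set.union_subset_union ih1 ih2

theorem size_le_of_mem_sub {φ χ : TPTL AP} (h : χ ∈ φ.sub) : χ.size ≤ φ.size := by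
  induction φ with
  | atom | tt | ff | freeze | ctr => rw [Set.mem_singleton_iff.1 h]
  | neg φ ih | box φ ih | boxPast φ ih =>
    rcases h with rfl | h
    · exact le_rfl
    · exact (ih h).trans (Nat.le_succ _)
  | and φ ψ ih1 ih2 | or φ ψ ih1 ih2 | untl φ ψ ih1 ih2 | snce φ ψ ih1 ih2 =>
    rcases h with rfl | h | h
    · exact le_rfl
    · exact (ih1 h).trans (by simp only [size]; lia)
    · exact (ih2 h).trans (by simp only [size]; lia)

theorem IsNNF.of_mem_sub {φ χ : TPTL AP} (hφ : φ.IsNNF) (h : χ ∈ φ.sub) : χ.IsNNF := by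
  induction φ with
  | atom | tt | ff | freeze | ctr => rwa [Set.mem_singleton_iff.1 h]
  | neg φ ih =>
    rcases h with rfl | h
    · exact hφ
    · obtain ⟨a, rfl⟩ := hφ
      rw [Set.mem_singleton_iff.1 h]
      trivial
  | box φ ih | boxPast φ ih =>
    rcases h with rfl | h
    · exact hφ
    · exact ih hφ h
  | and φ ψ ih1 ih2 | or φ ψ ih1 ih2 | untl φ ψ ih1 ih2 | snce φ ψ ih1 ih2 =>
    rcases h with rfl | h | h
    · exact hφ
    · exact ih1 hφ.1 h
    · exact ih2 hφ.2 h

theorem EachScope.of_mem_sub {R : Set TimeInterval → Prop} {φ χ : TPTL AP} (hφ : φ.EachScope R)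
    (h : χ ∈ φ.sub) : χ.EachScope R := by
  induction φ with
  | atom | tt | ff | freeze | ctr => rwa [Set.mem_singleton_iff.1 h]
  | neg φ ih | box φ ih | boxPast φ ih =>
    rcases h with rfl | h
    · exact hφ
    · exact ih hφ h
  | and φ ψ ih1 ih2 | or φ ψ ih1 ih2 | untl φ ψ ih1 ih2 | snce φ ψ ih1 ih2 =>
    rcases h with rfl | h | h
    · exact hφ
    · exact ih1 hφ.1 h
    · exact ih2 hφ.2 h

/-- Satisfaction with claims in place of constraints: the constraint `T - x ∈ I` counts as true at
position `i` if `I` is in the set `c i` of intervals claimed there. -/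
def SatC (ρ : TimedWord AP) (c : ℕ → Set TimeInterval) : TPTL AP → ℕ → Prop
  | atom a, i => a ∈ ρ.letter i
  | tt, i => i ∈ ρ.dom
  | ff, _ => False
  | neg φ, i => ¬ SatC ρ c φ i
  | and φ ψ, i => SatC ρ c φ i ∧ SatC ρ c ψ i
  | or φ ψ, i => SatC ρ c φ i ∨ SatC ρ c ψ i
  | untl φ ψ, i => ∃ j ∈ ρ.dom, i < j ∧ SatC ρ c ψ j ∧ ∀ l, i < l → l < j → SatC ρ c φ l
  | snce φ ψ, i => ∃ j ∈ ρ.dom, j < i ∧ SatC ρ c ψ j ∧ ∀ l, j < l → l < i → SatC ρ c φ l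
  | box φ, i => ∀ j ∈ ρ.dom, i < j → SatC ρ c φ j
  | boxPast φ, i => ∀ j ∈ ρ.dom, j < i → SatC ρ c φ j
  | freeze φ, i => Sat ρ φ i (ρ.time i)
  | ctr I, i => I ∈ c i

/-- The intervals of the constraints that are true at each position when the freeze variable has the
value `ν`. -/
def trueClaims (ρ : TimedWord AP) (ν : ℝ) (j : ℕ) : Set TimeInterval :=
  {I | ρ.time j - ν ∈ I.toSet}

theorem satC_trueClaims {ρ : TimedWord AP} {ν : ℝ} {φ : TPTL AP} {i : ℕ} :
    SatC ρ (trueClaims ρ ν) φ i ↔ Sat ρ φ i ν := by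
  induction φ generalizing i <;> simp_all [SatC, Sat, trueClaims]

theorem IsLeaf.sat_iff {ρ : TimedWord AP} {c : ℕ → Set TimeInterval} {φ : TPTL AP} {i : ℕ}
    (h : φ.IsLeaf) : SatC ρ c φ i ↔ Sat ρ φ i 0 := by
  cases φ <;> first | exact Iff.rfl | exact h.elim

theorem IsNNF.satC_mono {ρ : TimedWord AP} {c c' : ℕ → Set TimeInterval}
    (hc : ∀ j ∈ ρ.dom, c j ⊆ c' j) {φ : TPTL AP} (hφ : φ.IsNNF) {i : ℕ} (hi : i ∈ ρ.dom)
    (h : SatC ρ c φ i) : SatC ρ c' φ i := by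
  induction φ generalizing i with
  | atom | tt | ff | freeze => exact h
  | ctr I => exact hc i hi h
  | neg φ =>
    obtain ⟨a, rfl⟩ := hφ
    exact h
  | and φ ψ ih1 ih2 => exact ⟨ih1 hφ.1 hi h.1, ih2 hφ.2 hi h.2⟩
  | or φ ψ ih1 ih2 => exact h.imp (ih1 hφ.1 hi) (ih2 hφ.2 hi)
  | untl φ ψ ih1 ih2 =>
    obtain ⟨j, hj, hij, h1, h2⟩ := h
    exact ⟨j, hj, hij, ih2 hφ.2 hj h1, fun l hl hl' =>
      ih1 hφ.1 ⟨hi.1.trans hl.le, hl'.le.trans hj.2⟩ (h2 l hl hl')⟩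
  | snce φ ψ ih1 ih2 =>
    obtain ⟨j, hj, hij, h1, h2⟩ := h
    exact ⟨j, hj, hij, ih2 hφ.2 hj h1, fun l hl hl' =>
      ih1 hφ.1 ⟨hj.1.trans hl.le, hl'.le.trans hi.2⟩ (h2 l hl hl')⟩
  | box φ ih | boxPast φ ih => exact fun j hj hij => ih hφ hj (h j hj hij)

/-- Truth under claims that are true constraints implies truth. -/
def Robust (φ : TPTL AP) : Prop :=
  ∀ (ρ : TimedWord AP) (i : ℕ) (c : ℕ → Set TimeInterval), i ∈ ρ.dom →
    (∀ j ∈ ρ.dom, c j ⊆ trueClaims ρ (ρ.time i) j) → SatC ρ c φ i → Sat ρ φ i (ρ.time i)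

theorem IsNNF.robust {φ : TPTL AP} (hφ : φ.IsNNF) : φ.Robust :=
  fun _ _ _ hi hc h => satC_trueClaims.1 (hφ.satC_mono hc hi h)

/-! ### Coherent labellings of positions by sets of subformulae -/

/-- The conditions on a set of true formulae at a single position. -/
def LocalAt (q : Set (TPTL AP)) : TPTL AP → Prop
  | tt => tt ∈ q
  | ff => ff ∉ q
  | neg φ => neg φ ∈ q ↔ φ ∉ q
  | and φ ψ => and φ ψ ∈ q ↔ φ ∈ q ∧ ψ ∈ q
  | or φ ψ => or φ ψ ∈ q ↔ φ ∈ q ∨ ψ ∈ q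
  | _ => True

/-- The conditions on the sets `q` and `q'` of true formulae at two successive positions. -/
def StepAt (q q' : Set (TPTL AP)) : TPTL AP → Prop
  | untl φ ψ => untl φ ψ ∈ q ↔ ψ ∈ q' ∨ φ ∈ q' ∧ untl φ ψ ∈ q'
  | snce φ ψ => snce φ ψ ∈ q' ↔ ψ ∈ q ∨ φ ∈ q ∧ snce φ ψ ∈ q
  | box φ => box φ ∈ q ↔ φ ∈ q' ∧ box φ ∈ q'
  | boxPast φ => boxPast φ ∈ q' ↔ φ ∈ q ∧ boxPast φ ∈ q
  | _ => True

/-- The additional conditions at the first position. -/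
def FirstAt (q : Set (TPTL AP)) : TPTL AP → Prop
  | snce φ ψ => snce φ ψ ∉ q
  | boxPast φ => boxPast φ ∈ q
  | _ => True

/-- The additional conditions at the last position. -/
def LastAt (q : Set (TPTL AP)) : TPTL AP → Prop
  | untl φ ψ => untl φ ψ ∉ q
  | box φ => box φ ∈ q
  | _ => True

/-- The labelling `r` of the positions of `ρ` satisfies all local conditions that truth of the
subformulae of `θ` satisfies; labels contain constraints freely. -/
structure IsCoherent (θ : TPTL AP) (ρ : TimedWord AP) (r : ℕ → Set (TPTL AP)) : Prop where
  localAt : ∀ j ∈ ρ.dom, ∀ χ ∈ θ.sub, LocalAt (r j) χ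
  leaf : ∀ j ∈ ρ.dom, ∀ χ ∈ θ.sub, χ.IsLeaf → (χ ∈ r j ↔ Sat ρ χ j 0)
  step : ∀ j, 1 ≤ j → j < ρ.len → ∀ χ ∈ θ.sub, StepAt (r j) (r (j + 1)) χ
  first : ∀ χ ∈ θ.sub, FirstAt (r 1) χ
  last : ∀ χ ∈ θ.sub, LastAt (r ρ.len) χ

section Expansion

variable {ρ : TimedWord AP} {c : ℕ → Set TimeInterval} {φ ψ : TPTL AP} {j : ℕ}

theorem satC_untl_step (hj : j < ρ.len) :
    SatC ρ c (untl φ ψ) j ↔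
      SatC ρ c ψ (j + 1) ∨ SatC ρ c φ (j + 1) ∧ SatC ρ c (untl φ ψ) (j + 1) := by
  constructor
  · rintro ⟨l, hl, hjl, h, h'⟩
    rcases (Nat.succ_le_of_lt hjl).eq_or_lt with rfl | hlt
    · exact Or.inl h
    · exact Or.inr ⟨h' _ (Nat.lt_succ_self j) hlt, l, hl, hlt, h, fun x hx => h' x (by lia)⟩
  · rintro (h | ⟨h, l, hl, hjl, h1, h2⟩)
    · exact ⟨j + 1, ⟨by lia, hj⟩, by lia, h, fun l hl hl' => by lia⟩
    · refine ⟨l, hl, by lia, h1, fun x hx hx' => ?_⟩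
      rcases (Nat.succ_le_of_lt hx).eq_or_lt with rfl | hlt
      · exact h
      · exact h2 x hlt hx'

theorem satC_snce_step (h1 : 1 ≤ j) (hj : j < ρ.len) :
    SatC ρ c (snce φ ψ) (j + 1) ↔
      SatC ρ c ψ j ∨ SatC ρ c φ j ∧ SatC ρ c (snce φ ψ) j := by
  constructor
  · rintro ⟨l, hl, hjl, h, h'⟩
    rcases (Nat.lt_succ_iff.1 hjl).eq_or_lt with rfl | hlt
    · exact Or.inl h
    · exact Or.inr ⟨h' _ hlt (Nat.lt_succ_self j), l, hl, hlt, h,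
        fun x hx hx' => h' x hx (by lia)⟩
  · rintro (h | ⟨h, l, hl, hjl, h1, h2⟩)
    · exact ⟨j, ⟨h1, hj.le⟩, by lia, h, fun l hl hl' => by lia⟩
    · refine ⟨l, hl, by lia, h1, fun x hx hx' => ?_⟩
      rcases (Nat.lt_succ_iff.1 hx').eq_or_lt with rfl | hlt
      · exact h
      · exact h2 x hx hlt

theorem satC_box_step (hj : j < ρ.len) :
    SatC ρ c (box φ) j ↔ SatC ρ c φ (j + 1) ∧ SatC ρ c (box φ) (j + 1) := by
  constructor
  · exact fun h => ⟨h _ ⟨by lia, hj⟩ (by lia), fun l hl hjl => h l hl (by lia)⟩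
  · rintro ⟨h, h'⟩ l hl hjl
    rcases (Nat.succ_le_of_lt hjl).eq_or_lt with rfl | hlt
    · exact h
    · exact h' l hl hlt

theorem satC_boxPast_step (h1 : 1 ≤ j) (hj : j < ρ.len) :
    SatC ρ c (boxPast φ) (j + 1) ↔ SatC ρ c φ j ∧ SatC ρ c (boxPast φ) j := by
  constructor
  · exact fun h => ⟨h _ ⟨h1, hj.le⟩ (by lia), fun l hl hjl => h l hl (by lia)⟩
  · rintro ⟨h, h'⟩ l hl hjl
    rcases (Nat.lt_succ_iff.1 hjl).eq_or_lt with rfl | hlt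
    · exact h
    · exact h' l hl hlt

theorem not_satC_untl_last : ¬ SatC ρ c (untl φ ψ) ρ.len := by
  rintro ⟨l, hl, h, -⟩
  exact absurd hl.2 (not_le.2 h)

theorem not_satC_snce_first : ¬ SatC ρ c (snce φ ψ) 1 := by
  rintro ⟨l, hl, h, -⟩
  exact absurd hl.1 (not_le.2 h)

theorem satC_box_last : SatC ρ c (box φ) ρ.len := fun _ hl h => absurd hl.2 (not_le.2 h)

theorem satC_boxPast_first : SatC ρ c (boxPast φ) 1 := fun _ hl h => absurd hl.1 (not_le.2 h)

end Expansion

theorem isCoherent_satC (θ : TPTL AP) (ρ : TimedWord AP) (c : ℕ → Set TimeInterval) :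
    IsCoherent θ ρ fun j => {χ | χ ∈ θ.sub ∧ SatC ρ c χ j} where
  localAt j hj χ hχ := by
    have hs := sub_subset hχ
    cases χ with
    | tt => exact ⟨hχ, hj⟩
    | ff => exact fun h => h.2
    | neg φ =>
      have h1 : φ ∈ θ.sub := hs (Or.inr φ.self_mem_sub)
      simp [LocalAt, SatC, hχ, h1]
    | and φ ψ | or φ ψ =>
      have h1 : φ ∈ θ.sub := hs (Or.inr (Or.inl φ.self_mem_sub))
      have h2 : ψ ∈ θ.sub := hs (Or.inr (Or.inr ψ.self_mem_sub))
      simp [LocalAt, SatC, hχ, h1, h2]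
    | _ => trivial
  leaf j _ χ hχ hl := by
    rw [Set.mem_ofPred_eq, hl.sat_iff]
    exact and_iff_right hχ
  step j h1 hj χ hχ := by
    have hs := sub_subset hχ
    cases χ with
    | untl φ ψ =>
      have h3 : φ ∈ θ.sub := hs (Or.inr (Or.inl φ.self_mem_sub))
      have h4 : ψ ∈ θ.sub := hs (Or.inr (Or.inr ψ.self_mem_sub))
      simp only [StepAt, Set.mem_ofPred_eq, hχ, h3, h4, true_and]
      exact satC_untl_step hj
    | snce φ ψ =>
      have h3 : φ ∈ θ.sub := hs (Or.inr (Or.inl φ.self_mem_sub))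
      have h4 : ψ ∈ θ.sub := hs (Or.inr (Or.inr ψ.self_mem_sub))
      simp only [StepAt, Set.mem_ofPred_eq, hχ, h3, h4, true_and]
      exact satC_snce_step h1 hj
    | box φ =>
      have h3 : φ ∈ θ.sub := hs (Or.inr φ.self_mem_sub)
      simp only [StepAt, Set.mem_ofPred_eq, hχ, h3, true_and]
      exact satC_box_step hj
    | boxPast φ =>
      have h3 : φ ∈ θ.sub := hs (Or.inr φ.self_mem_sub)
      simp only [StepAt, Set.mem_ofPred_eq, hχ, h3, true_and]
      exact satC_boxPast_step h1 hj
    | _ => trivial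
  first χ hχ := by
    cases χ with
    | snce φ ψ => exact fun h => not_satC_snce_first h.2
    | boxPast φ => exact ⟨hχ, satC_boxPast_first⟩
    | _ => trivial
  last χ hχ := by
    cases χ with
    | untl φ ψ => exact fun h => not_satC_untl_last h.2
    | box φ => exact ⟨hχ, satC_box_last⟩
    | _ => trivial

/-- The local conditions determine a labelling from the constraints it contains. -/
theorem IsCoherent.mem_iff {θ : TPTL AP} {ρ : TimedWord AP} {r : ℕ → Set (TPTL AP)}
    (h : IsCoherent θ ρ r) {χ : TPTL AP} (hχ : χ ∈ θ.sub) {j : ℕ} (hj : j ∈ ρ.dom) :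
    χ ∈ r j ↔ SatC ρ (fun l => {I | ctr I ∈ r l}) χ j := by
  induction χ generalizing j with
  | atom a => exact h.leaf j hj _ hχ trivial
  | freeze φ => exact h.leaf j hj _ hχ trivial
  | tt => exact ⟨fun _ => hj, fun _ => h.localAt j hj _ hχ⟩
  | ff => exact ⟨fun h' => h.localAt j hj _ hχ h', False.elim⟩
  | ctr I => exact Iff.rfl
  | neg φ ih =>
    have h1 : φ ∈ θ.sub  := mem_of_sub hχ (Or.inr φ.self_mem_sub)
    exact (h.localAt j hj _ hχ).trans (not_congr (ih h1 hj))
  | and φ ψ ih1 ih2 =>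
    have h1 : φ ∈ θ.sub  := mem_of_sub hχ (Or.inr (Or.inl φ.self_mem_sub))
    have h2 : ψ ∈ θ.sub  := mem_of_sub hχ (Or.inr (Or.inr ψ.self_mem_sub))
    exact (h.localAt j hj _ hχ).trans
      (and_congr (ih1 h1 hj) (ih2 h2 hj))
  | or φ ψ ih1 ih2 =>
    have h1 : φ ∈ θ.sub  := mem_of_sub hχ (Or.inr (Or.inl φ.self_mem_sub))
    have h2 : ψ ∈ θ.sub  := mem_of_sub hχ (Or.inr (Or.inr ψ.self_mem_sub))
    exact (h.localAt j hj _ hχ).trans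
      (or_congr (ih1 h1 hj) (ih2 h2 hj))
  | untl φ ψ ih1 ih2 =>
    have h1 : φ ∈ θ.sub  := mem_of_sub hχ (Or.inr (Or.inl φ.self_mem_sub))
    have h2 : ψ ∈ θ.sub  := mem_of_sub hχ (Or.inr (Or.inr ψ.self_mem_sub))
    obtain ⟨hj1, hjn⟩ := hj
    induction hjn using Nat.decreasingInduction with
    | self => exact iff_of_false (h.last _ hχ) not_satC_untl_last
    | of_succ j hj' ih =>
      have hd : j + 1 ∈ ρ.dom := ⟨by lia, hj'⟩
      have ih' : untl φ ψ ∈ r (j + 1) ↔ _ := ih hd.1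
      rw [satC_untl_step hj', ← ih', ← ih1 h1 hd,
        ← ih2 h2 hd]
      exact h.step j hj1 hj' _ hχ
  | box φ ih1 =>
    have h1 : φ ∈ θ.sub  := mem_of_sub hχ (Or.inr φ.self_mem_sub)
    obtain ⟨hj1, hjn⟩ := hj
    induction hjn using Nat.decreasingInduction with
    | self => exact iff_of_true (h.last _ hχ) satC_box_last
    | of_succ j hj' ih =>
      have hd : j + 1 ∈ ρ.dom := ⟨by lia, hj'⟩
      have ih' : box φ ∈ r (j + 1) ↔ _ := ih hd.1
      rw [satC_box_step hj', ← ih', ← ih1 h1 hd]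
      exact h.step j hj1 hj' _ hχ
  | snce φ ψ ih1 ih2 =>
    have h1 : φ ∈ θ.sub  := mem_of_sub hχ (Or.inr (Or.inl φ.self_mem_sub))
    have h2 : ψ ∈ θ.sub  := mem_of_sub hχ (Or.inr (Or.inr ψ.self_mem_sub))
    obtain ⟨hj1, hjn⟩ := hj
    induction j, hj1 using Nat.le_induction with
    | base => exact iff_of_false (h.first _ hχ) not_satC_snce_first
    | succ j hj1 ih =>
      have hd : j ∈ ρ.dom := ⟨hj1, by lia⟩
      have ih' : snce φ ψ ∈ r j ↔ _ := ih hd.2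
      rw [satC_snce_step hj1 hjn, ← ih', ← ih1 h1 hd,
        ← ih2 h2 hd]
      exact h.step j hj1 hjn _ hχ
  | boxPast φ ih1 =>
    have h1 : φ ∈ θ.sub  := mem_of_sub hχ (Or.inr φ.self_mem_sub)
    obtain ⟨hj1, hjn⟩ := hj
    induction j, hj1 using Nat.le_induction with
    | base => exact iff_of_true (h.first _ hχ) satC_boxPast_first
    | succ j hj1 ih =>
      have hd : j ∈ ρ.dom := ⟨hj1, by lia⟩
      have ih' : boxPast φ ∈ r j ↔ _ := ih hd.2
      rw [satC_boxPast_step hj1 hjn, ← ih', ← ih1 h1 hd]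
      exact h.step j hj1 hjn _ hχ

end TPTL

/-! ### The modalities for one freeze quantifier -/

namespace TPTL

variable {AP : Type*}

/-- The states of the automata for `θ`: sets of subformulae of `θ`. -/
def State (θ : TPTL AP) : Type _ := ↥(𝒫 θ.sub)

instance (θ : TPTL AP) : Finite θ.State := θ.finite_sub.finite_subsets.to_subtype

theorem card_state_le (θ : TPTL AP) : Nat.card θ.State ≤ 2 ^ θ.size := by
  have : Nat.card θ.State = 2 ^ θ.sub.ncard := Set.ncard_powerset _ θ.finite_sub
  rw [this]
  exact Nat.pow_le_pow_right (by lia) θ.ncard_sub_le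

/-- The intervals of the constraints in a state. -/
def State.claims {θ : TPTL AP} (q : θ.State) : Set TimeInterval := {I | ctr I ∈ q.1}

/-- The reflected intervals of the constraints in a state, which are the conditions on the time that
elapses from a past position to the current one. -/
def State.pastClaims {θ : TPTL AP} (q : θ.State) : Set TimeInterval := TimeInterval.neg '' q.claims

theorem State.claims_subset {θ : TPTL AP} (q : θ.State) : q.claims ⊆ θ.scopeIntervals :=
  fun _ hI => mem_scopeIntervals.2 (q.2 hI)

section

variable (θ : TPTL AP) {m : ℕ} (lf : Fin m → TPTL AP)

/-- The state `q` satisfies the local conditions at a position at which the leaves with indices in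
`b` are true. -/
def State.Fits (q : θ.State) (b : Set (Fin m)) : Prop :=
  (∀ χ ∈ θ.sub, LocalAt q.1 χ) ∧ ∀ j, lf j ∈ q.1 ↔ j ∈ b

/-- The step relation of the automata that read the positions after the current one. -/
def futStep (q : θ.State) (b : Set (Fin m)) (q' : θ.State) : Prop :=
  (∀ χ ∈ θ.sub, StepAt q.1 q'.1 χ) ∧ q'.Fits θ lf b

/-- The step relation of the automata that read the positions before the current one, backwards. -/
def pastStep (q : θ.State) (b : Set (Fin m)) (q' : θ.State) : Prop :=
  (∀ χ ∈ θ.sub, StepAt q'.1 q.1 χ) ∧ q'.Fits θ lf b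

/-- The states admitted at the last position. -/
def finalStates : Set θ.State := {q | ∀ χ ∈ θ.sub, LastAt q.1 χ}

/-- The states admitted at the first position. -/
def initialStates : Set θ.State := {q | ∀ χ ∈ θ.sub, FirstAt q.1 χ}

/-- The states admitted at the position of the freeze quantifier, up to the truth of leaves: `θ` is
true, and the true constraints are those with `0 ∈ I`. -/
def freezeStates : Set θ.State :=
  {q | θ ∈ q.1 ∧ (∀ χ ∈ θ.sub, LocalAt q.1 χ) ∧
    ∀ I ∈ θ.scopeIntervals, (ctr I ∈ q.1 ↔ (0 : ℝ) ∈ I.toSet)}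

/-- The arity of the modalities for `θ`: two cut points per interval, and one more to make the arity
positive. -/
noncomputable def cutArity : ℕ := 2 * θ.scopeIntervals.ncard + 1

theorem one_le_cutArity : 1 ≤ θ.cutArity := Nat.le_add_left _ _

variable (K : Set TimeInterval → {I : TimeInterval // I.IsNat}) (S : Fin m → PnEMTL AP)

/-- The modality for the future of the current position, with prescribed states at the cut
points. -/
noncomputable def futModality (s : Fin (θ.cutArity + 1) → θ.State) : PnEMTL AP :=
  .fut θ.cutArity m θ.one_le_cutArity (fun w => K (s w.succ).claims)
    (chainAutomata (θ.futStep lf) State.claims θ.finalStates s) S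

/-- The modality for the past of the current position, with prescribed states at the cut points. -/
noncomputable def pastModality (s : Fin (θ.cutArity + 1) → θ.State) : PnEMTL AP :=
  .past θ.cutArity m θ.one_le_cutArity (fun w => K (s w.succ).pastClaims)
    (chainAutomata (θ.pastStep lf) State.pastClaims θ.initialStates s) S

open Classical in
/-- The leaves that are true at the current position are those in the state `q`. -/
noncomputable def leafFormula (q : θ.State) : PnEMTL AP :=
  .conj ((List.finRange m).map fun j => if lf j ∈ q.1 then S j else .neg (S j))

/-- The choices of states at the cut points on both sides of the current position. -/
noncomputable def cutStates :
    List ((Fin (θ.cutArity + 1) → θ.State) × (Fin (θ.cutArity + 1) → θ.State)) :=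
  (Set.toFinite {x : (Fin (θ.cutArity + 1) → θ.State) × (Fin (θ.cutArity + 1) → θ.State) |
    x.1 0 = x.2 0 ∧ x.1 0 ∈ θ.freezeStates}).toFinset.toList

/-- The translation of `x.θ`, where `S j` translates the leaf `lf j` and `K D` is the intersection of
`[0, ∞)` with the members of `D`. -/
noncomputable def freezeFormula : PnEMTL AP :=
  .disj (θ.cutStates.map fun x => .and (θ.leafFormula lf S (x.1 0))
    (.and (θ.futModality lf K S x.1) (θ.pastModality lf K S x.2)))

theorem mem_cutStates
    {x : (Fin (θ.cutArity + 1) → θ.State) × (Fin (θ.cutArity + 1) → θ.State)} :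
    x ∈ θ.cutStates ↔ x.1 0 = x.2 0 ∧ x.1 0 ∈ θ.freezeStates := by
  simp [cutStates]

theorem sat_leafFormula {ρ : TimedWord AP} {i : ℕ} {q : θ.State} :
    (θ.leafFormula lf S q).Sat ρ i ↔ ∀ j, lf j ∈ q.1 ↔ (S j).Sat ρ i := by
  simp only [leafFormula, PnEMTL.sat_conj, List.forall_mem_map, List.mem_finRange, true_imp_iff]
  refine forall_congr' fun j => ?_
  split_ifs with h <;> simp [h, PnEMTL.Sat]

end

section Correctness

variable {θ : TPTL AP} {m : ℕ} {lf : Fin m → TPTL AP}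
  {K : Set TimeInterval → {I : TimeInterval // I.IsNat}} {S : Fin m → PnEMTL AP}

/-- The runs on the two sides of the current position form one coherent labelling, all of whose claims
are true, so that robustness applies. -/
theorem sat_of_sat_freezeFormula (hθ : θ.Robust)
    (hlf : ∀ χ ∈ θ.sub, χ.IsLeaf → ∃ j, lf j = χ)
    (hS : ∀ ρ : TimedWord AP, ∀ i ∈ ρ.dom, ∀ j, (lf j).Sat ρ i 0 ↔ (S j).Sat ρ i)
    (hK : ∀ q : θ.State, TimeInterval.IsNatInter q.claims (K q.claims).1)
    (hK' : ∀ q : θ.State, TimeInterval.IsNatInter q.pastClaims (K q.pastClaims).1)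
    {ρ : TimedWord AP} {i : ℕ} (hi : i ∈ ρ.dom) (h : (θ.freezeFormula lf K S).Sat ρ i) :
    θ.Sat ρ i (ρ.time i) := by
  obtain ⟨hi1, hin⟩ := id hi
  obtain ⟨_, hx, h⟩ := PnEMTL.sat_disj.1 h
  obtain ⟨⟨s, s'⟩, hss, rfl⟩ := List.mem_map.1 hx
  obtain ⟨hs0, hθs, hloc, hcl⟩ := (θ.mem_cutStates).1 hss
  obtain ⟨hleaf, hfut, hpast⟩ := h
  dsimp only at hs0 hθs hloc hcl hleaf hfut hpast
  rw [sat_leafFormula] at hleaf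
  rw [futModality, PnEMTL.sat_fut_iff_chain hi] at hfut
  rw [pastModality, PnEMTL.sat_past_iff_chain hi] at hpast
  obtain ⟨r, hr0, hr, hrF, hrc⟩ := hfut.exists_run (by simp)
    (fun d e hde he => sub_le_sub_right (ρ.time_mono _ _ (by lia) (by lia) (by lia)) _)
    (fun w => hK _) (fun J hJ => (hcl J (State.claims_subset _ hJ)).1 hJ)
  obtain ⟨r', hr0', hr', hrF', hrc'⟩ := hpast.exists_run (by simp)
    (fun d e hde he => sub_le_sub_left (ρ.time_mono _ _ (by lia) (by lia) (by lia)) _)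
    (fun w => hK' _) (by
      rintro _ ⟨J, hJ, rfl⟩
      rw [TimeInterval.mem_toSet_neg, neg_zero]
      rw [← hs0] at hJ
      exact (hcl J (State.claims_subset _ hJ)).1 hJ)
  -- The two runs agree at the current position, and together label all positions.
  set R : ℕ → Set (TPTL AP) := fun j => if i ≤ j then (r (j - i)).1 else (r' (i - j)).1 with hR
  have hRf : ∀ d, R (i + d) = (r d).1 := fun d => by simp [hR]
  have hRp : ∀ d, d ≤ i → R (i - d) = (r' d).1 := fun d hd => by
    rcases Nat.eq_zero_or_pos d with rfl | hd0
    · simp [hR, hr0, hr0', hs0]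
    · have h1 : ¬ i ≤ i - d := by lia
      have h2 : i - (i - d) = d := by lia
      simp only [hR, h1, if_false, h2]
  have hdom : ∀ j ∈ ρ.dom, (∃ d ≤ ρ.len - i, j = i + d) ∨ ∃ d, 1 ≤ d ∧ d ≤ i - 1 ∧ j = i - d := by
    rintro j ⟨hj1, hjn⟩
    rcases le_or_gt i j with hij | hij
    · exact Or.inl ⟨j - i, by lia, by lia⟩
    · exact Or.inr ⟨i - j, by lia, by lia, by lia⟩
  have hfits : ∀ j ∈ ρ.dom, (∀ χ ∈ θ.sub, LocalAt (R j) χ) ∧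
      ∀ l, lf l ∈ R j ↔ (S l).Sat ρ j := by
    intro j hj
    rcases hdom j hj with ⟨d, hd, rfl⟩ | ⟨d, hd1, hd, rfl⟩
    · rcases d with _ | d
      · rw [hRf, hr0]
        exact ⟨hloc, hleaf⟩
      · rw [hRf]
        exact (hr d (by lia)).2
    · obtain ⟨d, rfl⟩ := Nat.exists_eq_add_of_le' hd1
      rw [hRp _ (by lia)]
      exact (hr' d (by lia)).2
  have hstep : ∀ j, 1 ≤ j → j < ρ.len → ∀ χ ∈ θ.sub, StepAt (R j) (R (j + 1)) χ := by
    intro j hj1 hjn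
    rcases hdom j ⟨hj1, hjn.le⟩ with ⟨d, hd, rfl⟩ | ⟨d, hd1, hd, rfl⟩
    · rw [hRf, add_assoc, hRf]
      exact (hr d (by lia)).1
    · obtain ⟨d, rfl⟩ := Nat.exists_eq_add_of_le' hd1
      have h1 : i - (d + 1) + 1 = i - d := by lia
      rw [h1, hRp _ (by lia), hRp _ (by lia)]
      exact (hr' d (by lia)).1
  have hcoh : IsCoherent θ ρ R :=
    { localAt := fun j hj => (hfits j hj).1
      leaf := by
        intro j hj χ hχ hl
        obtain ⟨l, rfl⟩ := hlf χ hχ hl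
        rw [hS ρ j hj]
        exact (hfits j hj).2 l
      step := hstep
      first := by
        have h1 : 1 = i - (i - 1) := by lia
        rw [h1, hRp _ (by lia)]
        exact hrF'
      last := by
        have h1 : ρ.len = i + (ρ.len - i) := by lia
        rw [h1, hRf]
        exact hrF }
  refine hθ ρ i _ hi ?_ ((hcoh.mem_iff θ.self_mem_sub hi).1 ?_)
  · intro j hj I hI
    rcases hdom j hj with ⟨d, hd, rfl⟩ | ⟨d, hd1, hd, rfl⟩
    · have hI' : ctr I ∈ R (i + d) := hI
      rw [hRf] at hI'
      exact hrc d hd I hI'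
    · have hI' : ctr I ∈ R (i - d) := hI
      rw [hRp _ (by lia)] at hI'
      have h2 := hrc' d hd _ ⟨I, hI', rfl⟩
      rw [TimeInterval.mem_toSet_neg, neg_sub] at h2
      exact h2
  · have h1 := hRf 0
    rw [add_zero] at h1
    rw [h1, hr0]
    exact hθs

/-- The labelling by the true subformulae provides runs on both sides with exact claims. -/
theorem sat_freezeFormula_of_sat
    (hlf : ∀ j, lf j ∈ θ.sub ∧ (lf j).IsLeaf)
    (hS : ∀ ρ : TimedWord AP, ∀ i ∈ ρ.dom, ∀ j, (lf j).Sat ρ i 0 ↔ (S j).Sat ρ i)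
    (hK : ∀ q : θ.State, TimeInterval.IsNatInter q.claims (K q.claims).1)
    (hK' : ∀ q : θ.State, TimeInterval.IsNatInter q.pastClaims (K q.pastClaims).1)
    {ρ : TimedWord AP} {i : ℕ} (hi : i ∈ ρ.dom) (h : θ.Sat ρ i (ρ.time i)) :
    (θ.freezeFormula lf K S).Sat ρ i := by
  classical
  obtain ⟨hi1, hin⟩ := id hi
  set c := trueClaims ρ (ρ.time i) with hc
  set R : ℕ → θ.State := fun j => ⟨{χ | χ ∈ θ.sub ∧ SatC ρ c χ j}, fun _ h => h.1⟩ with hR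
  have hcoh : IsCoherent θ ρ fun j => (R j).1 := isCoherent_satC θ ρ c
  have hfits : ∀ j ∈ ρ.dom, (R j).Fits θ lf {l | (S l).Sat ρ j} := fun j hj =>
    ⟨hcoh.localAt j hj, fun l => (hcoh.leaf j hj _ (hlf l).1 (hlf l).2).trans (hS ρ j hj l)⟩
  have hclaims : ∀ j, (R j).claims =
      {I | I ∈ θ.finite_scopeIntervals.toFinset ∧ ρ.time j - ρ.time i ∈ I.toSet} := by
    intro j
    ext I
    rw [Set.mem_ofPred_eq, Set.Finite.mem_toFinset, mem_scopeIntervals]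
    exact Iff.rfl
  have hpastClaims : ∀ j, (R j).pastClaims =
      {I | I ∈ θ.finite_scopeIntervals.toFinset.image TimeInterval.neg ∧
        ρ.time i - ρ.time j ∈ I.toSet} := by
    intro j
    ext I
    simp only [State.pastClaims, hclaims, Set.mem_image, Set.mem_ofPred_eq, Finset.mem_image]
    constructor
    · rintro ⟨J, ⟨hJ, hJ'⟩, rfl⟩
      exact ⟨⟨J, hJ, rfl⟩, by rwa [TimeInterval.mem_toSet_neg, neg_sub]⟩
    · rintro ⟨⟨J, hJ, rfl⟩, hJ'⟩
      rw [TimeInterval.mem_toSet_neg, neg_sub] at hJ'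
      exact ⟨J, ⟨hJ, hJ'⟩, rfl⟩
  have hcard : 2 * θ.finite_scopeIntervals.toFinset.card ≤ θ.cutArity := by
    rw [cutArity, Set.ncard_eq_toFinset_card _ θ.finite_scopeIntervals]
    lia
  obtain ⟨s, hs0, hs⟩ := exists_chain (L := ρ.len - i) (k := θ.cutArity)
    (R := θ.futStep lf) (cl := State.claims) (F := θ.finalStates)
    (δ := fun d => ρ.time (i + d) - ρ.time i) (b := fun d => {j | (S j).Sat ρ (i + d)})
    (K := fun D => (K D).1) (r := fun d => R (i + d)) (by simp)
    (fun d e hde he => sub_le_sub_right (ρ.time_mono _ _ (by lia) (by lia) (by lia)) _)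
    hK _ hcard
    (fun d hd => ⟨hcoh.step _ (by lia) (by lia), hfits _ ⟨by lia, by lia⟩⟩)
    (by
      have h1 : i + (ρ.len - i) = ρ.len := by lia
      rw [h1]
      exact hcoh.last)
    (fun d hd => hclaims _)
  obtain ⟨s', hs0', hs'⟩ := exists_chain (L := i - 1) (k := θ.cutArity)
    (R := θ.pastStep lf) (cl := State.pastClaims) (F := θ.initialStates)
    (δ := fun d => ρ.time i - ρ.time (i - d)) (b := fun d => {j | (S j).Sat ρ (i - d)})
    (K := fun D => (K D).1) (r := fun d => R (i - d)) (by simp)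
    (fun d e hde he => sub_le_sub_left (ρ.time_mono _ _ (by lia) (by lia) (by lia)) _)
    hK' _ ((Nat.mul_le_mul_left _ Finset.card_image_le).trans hcard)
    (fun d hd => by
      have h1 : i - (d + 1) + 1 = i - d := by lia
      have h2 := hcoh.step (i - (d + 1)) (by lia) (by lia)
      rw [h1] at h2
      exact ⟨h2, hfits _ ⟨by lia, by lia⟩⟩)
    (by
      have h1 : i - (i - 1) = 1 := by lia
      rw [h1]
      exact hcoh.first)
    (fun d hd => hpastClaims _)
  simp only [add_zero, tsub_zero] at hs0 hs0'
  refine PnEMTL.sat_disj.2 ⟨_, List.mem_map_of_mem (a := (s, s')) ?_, ?_, ?_, ?_⟩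
  · refine (θ.mem_cutStates).2 ⟨hs0.trans hs0'.symm, ?_⟩
    simp only [hs0]
    refine ⟨⟨θ.self_mem_sub, satC_trueClaims.2 h⟩, hcoh.localAt i hi, fun I hI => ?_⟩
    have h1 := Set.ext_iff.1 (hclaims i) I
    rw [Set.mem_ofPred_eq, Set.Finite.mem_toFinset, sub_self, and_iff_right hI] at h1
    exact h1
  · rw [sat_leafFormula]
    simp only [hs0]
    exact (hfits i hi).2
  · rw [futModality, PnEMTL.sat_fut_iff_chain hi]
    exact hs
  · rw [pastModality, PnEMTL.sat_past_iff_chain hi]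
    exact hs'

end Correctness

end TPTL

namespace TPTL

variable {AP : Type*}

/-! ### Size, arity and non-adjacency of the translation of one freeze quantifier -/

section Bounds

variable {θ : TPTL AP} {m : ℕ} {lf : Fin m → TPTL AP}
  {K : Set TimeInterval → {I : TimeInterval // I.IsNat}} {S : Fin m → PnEMTL AP}

theorem ncard_scopeIntervals_le (θ : TPTL AP) : θ.scopeIntervals.ncard ≤ θ.size := by
  refine le_trans ?_ θ.ncard_sub_le
  refine Set.ncard_le_ncard_of_injOn ctr (fun I hI => mem_scopeIntervals.1 hI) ?_ θ.finite_sub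
  exact fun I _ J _ h => ctr.inj h

theorem size_le_of_mem_scopeIntervals {I : TimeInterval} (hI : I ∈ θ.scopeIntervals) :
    I.size ≤ θ.size :=
  (Nat.le_succ _).trans (size_le_of_mem_sub (mem_scopeIntervals.1 hI))

theorem length_cutStates_le (θ : TPTL AP) :
    θ.cutStates.length ≤ (2 ^ θ.size) ^ (4 * θ.size + 4) := by
  have h1 : θ.cutStates.length ≤ Nat.card
      ((Fin (θ.cutArity + 1) → θ.State) × (Fin (θ.cutArity + 1) → θ.State)) := by
    rw [cutStates, Finset.length_toList, ← Set.ncard_eq_toFinset_card]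
    exact Set.ncard_le_card _
  refine h1.trans ?_
  have h2 := θ.ncard_scopeIntervals_le
  rw [Nat.card_prod, Nat.card_fun, Nat.card_fin, ← pow_add]
  refine (Nat.pow_le_pow_left θ.card_state_le _).trans (Nat.pow_le_pow_right (by positivity) ?_)
  rw [cutArity]
  lia

/-- A bound for the size of a modality for `θ` in which `2 ^ θ.size` replaces the numbers of states,
letters, arguments and cut points. -/
theorem size_modality_le {k : ℕ} (hk : k ≤ 2 * θ.size + 1) (hm : m ≤ θ.size) {X : ℕ}
    (hS : ∀ j, (S j).size ≤ X) (I : Fin k → {I : TimeInterval // I.IsNat})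
    (hI : ∀ w, (I w).1.size ≤ 2 * θ.size + 2) (A : Fin (k + 1) → Automaton m)
    (hA : ∀ w, (A w).size ≤ Nat.card θ.State + Nat.card θ.State * (2 ^ m * Nat.card θ.State)) :
    (∑ w, (I w).1.size) + (∑ w, (A w).size) + (∑ j, (S j).size) + 1 ≤
      (2 * 2 ^ θ.size + 1) * (2 * 2 ^ θ.size + 2) +
      (2 * 2 ^ θ.size + 2) * (2 ^ θ.size + 2 ^ θ.size * (2 ^ θ.size * 2 ^ θ.size)) +
      2 ^ θ.size * X + 1 := by
  have hn : θ.size ≤ 2 ^ θ.size := Nat.lt_two_pow_self.le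
  have hQ := θ.card_state_le
  have h2m : 2 ^ m ≤ 2 ^ θ.size := Nat.pow_le_pow_right (by lia) hm
  have h1 : ∑ w, (I w).1.size ≤ (2 * 2 ^ θ.size + 1) * (2 * 2 ^ θ.size + 2) := by
    refine (Finset.sum_le_card_nsmul _ _ _ fun w _ => hI w).trans ?_
    rw [Finset.card_univ, Fintype.card_fin, smul_eq_mul]
    exact Nat.mul_le_mul (by lia) (by lia)
  have h2 : ∑ w, (A w).size ≤
      (2 * 2 ^ θ.size + 2) * (2 ^ θ.size + 2 ^ θ.size * (2 ^ θ.size * 2 ^ θ.size)) := by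
    refine (Finset.sum_le_card_nsmul _ _ _ fun w _ => hA w).trans ?_
    rw [Finset.card_univ, Fintype.card_fin, smul_eq_mul]
    exact Nat.mul_le_mul (by lia) (by gcongr)
  have h3 : ∑ j, (S j).size ≤ 2 ^ θ.size * X := by
    refine (Finset.sum_le_card_nsmul _ _ _ fun j _ => hS j).trans ?_
    rw [Finset.card_univ, Fintype.card_fin, smul_eq_mul]
    exact Nat.mul_le_mul_right _ (by lia)
  lia

theorem size_freezeFormula_le (hm : m ≤ θ.size) {X : ℕ} (hX : 1 ≤ X) (hS : ∀ j, (S j).size ≤ X)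
    (hK : ∀ q : θ.State, (K q.claims).1.size ≤ 2 * θ.size + 2)
    (hK' : ∀ q : θ.State, (K q.pastClaims).1.size ≤ 2 * θ.size + 2) :
    (θ.freezeFormula lf K S).size ≤ 2 ^ (θ.size * (4 * θ.size + 17)) * X := by
  have hk : θ.cutArity ≤ 2 * θ.size + 1 := by
    have := θ.ncard_scopeIntervals_le
    rw [cutArity]
    lia
  have hn0 : 1 ≤ θ.size := by cases θ <;> simp [size]
  have hn : θ.size ≤ 2 ^ θ.size := Nat.lt_two_pow_self.le
  have hE : 2 ≤ 2 ^ θ.size := by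
    calc 2 = 2 ^ 1 := rfl
      _ ≤ _ := Nat.pow_le_pow_right (by lia) hn0
  have hlen := θ.length_cutStates_le
  have hdisj : ∀ β ∈ θ.cutStates.map fun x => PnEMTL.and (θ.leafFormula lf S (x.1 0))
      (.and (θ.futModality lf K S x.1) (θ.pastModality lf K S x.2)),
      β.size + 2 ≤ (2 ^ θ.size) ^ 10 * X := by
    intro β hβ
    obtain ⟨⟨s, s'⟩, -, rfl⟩ := List.mem_map.1 hβ
    have h1 : (θ.leafFormula lf S (s 0)).size ≤ 2 ^ θ.size * (X + 2) + 4 := by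
      refine (PnEMTL.size_conj_le (X := X + 1) ?_).trans ?_
      · simp only [List.forall_mem_map]
        intro j _
        split_ifs
        · exact (hS j).trans (Nat.le_succ _)
        · exact Nat.succ_le_succ (hS j)
      · rw [List.length_map, List.length_finRange]
        exact Nat.add_le_add_right (Nat.mul_le_mul_right _ (by lia)) _
    have h2 : (θ.futModality lf K S s).size ≤ _ :=
      size_modality_le hk hm hS _ (fun w => hK _) _ (size_chainAutomata_le _ _ _ _)
    have h3 : (θ.pastModality lf K S s').size ≤ _ :=
      size_modality_le hk hm hS _ (fun w => hK' _) _ (size_chainAutomata_le _ _ _ _)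
    simp only [PnEMTL.size]
    generalize 2 ^ θ.size = E at *
    -- Every summand is at most a constant times `E ^ 4 * X`, and `64 ≤ E ^ 6`.
    have e1 : E ≤ E ^ 4 := Nat.le_self_pow (by lia) E
    have e2 : E ^ 2 ≤ E ^ 4 := Nat.pow_le_pow_right (by lia) (by lia)
    have e3 : E ^ 3 ≤ E ^ 4 := Nat.pow_le_pow_right (by lia) (by lia)
    have e0 : 16 ≤ E ^ 4 := by
      calc 16 = 2 ^ 4 := rfl
        _ ≤ _ := Nat.pow_le_pow_left hE 4
    have e6 : 64 ≤ E ^ 6 := by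
      calc 64 = 2 ^ 6 := rfl
        _ ≤ _ := Nat.pow_le_pow_left hE 6
    have e4 : E ^ 4 ≤ E ^ 4 * X := Nat.le_mul_of_pos_right _ hX
    have e5 : E * X ≤ E ^ 4 * X := Nat.mul_le_mul_right _ e1
    have e7 : 64 * (E ^ 4 * X) ≤ E ^ 10 * X := by
      calc 64 * (E ^ 4 * X) ≤ E ^ 6 * (E ^ 4 * X) := Nat.mul_le_mul_right _ e6
        _ = E ^ 10 * X := by ring
    ring_nf at h1 h2 h3
    lia
  have h := PnEMTL.size_disj_le (X := (2 ^ θ.size) ^ 10 * X - 2) fun β hβ => by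
    have := hdisj β hβ
    lia
  have hpos : 2 ≤ (2 ^ θ.size) ^ 10 * X := by
    calc 2 ≤ 2 ^ θ.size := hE
      _ ≤ (2 ^ θ.size) ^ 10 := Nat.le_self_pow (by lia) _
      _ ≤ _ := Nat.le_mul_of_pos_right _ hX
  rw [List.length_map, Nat.sub_add_cancel hpos] at h
  refine h.trans ?_
  rw [pow_mul]
  generalize 2 ^ θ.size = E at *
  have e8 : 8 ≤ E ^ 3 := by
    calc 8 = 2 ^ 3 := rfl
      _ ≤ _ := Nat.pow_le_pow_left hE 3
  have e9 : 1 ≤ E ^ (4 * θ.size + 4) * (E ^ 10 * X) := by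
    have : 1 ≤ E := by lia
    exact Nat.mul_pos (Nat.pow_pos this) (by lia)
  calc θ.cutStates.length * (E ^ 10 * X) + 5
      ≤ E ^ (4 * θ.size + 4) * (E ^ 10 * X) + 5 :=
        Nat.add_le_add_right (Nat.mul_le_mul_right _ hlen) _
    _ ≤ 8 * (E ^ (4 * θ.size + 4) * (E ^ 10 * X)) := by lia
    _ ≤ E ^ 3 * (E ^ (4 * θ.size + 4) * (E ^ 10 * X)) := Nat.mul_le_mul_right _ e8
    _ = E ^ (4 * θ.size + 17) * X := by ring

theorem arity_freezeFormula_le {N : ℕ} (hN : θ.cutArity ≤ N) (hS : ∀ j, (S j).arity ≤ N) :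
    (θ.freezeFormula lf K S).arity ≤ N := by
  have hN1 : 1 ≤ N := θ.one_le_cutArity.trans hN
  refine PnEMTL.arity_disj_le hN1 ?_
  simp only [List.forall_mem_map]
  intro x _
  have hsup : (Finset.univ.sup fun j => (S j).arity) ≤ N := Finset.sup_le fun j _ => hS j
  refine max_le (PnEMTL.arity_conj_le hN1 ?_) (max_le (max_le hN hsup) (max_le hN hsup))
  simp only [List.forall_mem_map]
  intro j _
  split_ifs <;> exact hS j

theorem futNonAdjacent_freezeFormula (h : TimeInterval.PosNonAdjacent θ.scopeIntervals)
    (hK : ∀ q : θ.State, TimeInterval.IsNatInter q.claims (K q.claims).1)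
    (hS : ∀ j, (S j).FutNonAdjacent) : (θ.freezeFormula lf K S).FutNonAdjacent := by
  refine PnEMTL.futNonAdjacent_disj ?_
  simp only [List.forall_mem_map]
  intro x _
  refine ⟨PnEMTL.futNonAdjacent_conj ?_, ⟨h.nonAdjacent_of_isNatInter ?_, hS⟩, hS⟩
  · simp only [List.forall_mem_map]
    intro j _
    split_ifs <;> exact hS j
  · rintro _ ⟨w, rfl⟩
    exact ⟨_, State.claims_subset _, hK _⟩

theorem pastNonAdjacent_freezeFormula (h : TimeInterval.NegNonAdjacent θ.scopeIntervals)
    (hK' : ∀ q : θ.State, TimeInterval.IsNatInter q.pastClaims (K q.pastClaims).1)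
    (hS : ∀ j, (S j).PastNonAdjacent) : (θ.freezeFormula lf K S).PastNonAdjacent := by
  refine PnEMTL.pastNonAdjacent_disj ?_
  simp only [List.forall_mem_map]
  intro x _
  refine ⟨PnEMTL.pastNonAdjacent_conj ?_, hS, h.image_neg.nonAdjacent_of_isNatInter ?_, hS⟩
  · simp only [List.forall_mem_map]
    intro j _
    split_ifs <;> exact hS j
  · rintro _ ⟨w, rfl⟩
    exact ⟨_, Set.image_mono (State.claims_subset _), hK' _⟩

end Bounds

end TPTL

/-! ### Making claims exact -/

namespace TimeInterval

/-- The real numbers below all members of `I`; if `I` has no lower bound, an empty interval. -/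
def below (I : TimeInterval) : TimeInterval :=
  match I.lower with
  | .infinite => ⟨.excluded 0, .excluded 0⟩
  | .excluded a => ⟨.infinite, .included a⟩
  | .included a => ⟨.infinite, .excluded a⟩

/-- The real numbers above all members of `I`; if `I` has no upper bound, an empty interval. -/
def above (I : TimeInterval) : TimeInterval :=
  match I.upper with
  | .infinite => ⟨.excluded 0, .excluded 0⟩
  | .excluded a => ⟨.included a, .infinite⟩
  | .included a => ⟨.excluded a, .infinite⟩

theorem notMem_toSet_iff {I : TimeInterval} {r : ℝ} :
    r ∉ I.toSet ↔ r ∈ I.below.toSet ∨ r ∈ I.above.toSet := by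
  simp only [mem_toSet, not_and_or]
  refine or_congr ?_ ?_
  · rcases I with ⟨_ | a | a, u⟩ <;>
      simp [below, Endpoint.LowerHolds, Endpoint.UpperHolds]
    exact le_of_lt
  · rcases I with ⟨l, _ | a | a⟩ <;>
      simp [above, Endpoint.LowerHolds, Endpoint.UpperHolds]
    exact le_of_lt

theorem two_le_size (I : TimeInterval) : 2 ≤ I.size :=
  Nat.add_le_add I.lower.size_pos I.upper.size_pos

theorem size_below_le (I : TimeInterval) : I.below.size ≤ I.size := by
  have := I.upper.size_pos
  rcases I with ⟨_ | a | a, u⟩ <;> simp [below, size, Endpoint.size] at * <;> lia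

theorem size_above_le (I : TimeInterval) : I.above.size ≤ I.size := by
  have := I.lower.size_pos
  rcases I with ⟨l, _ | a | a⟩ <;> simp [above, size, Endpoint.size] at * <;> lia

end TimeInterval

namespace TPTL

variable {AP : Type*}

/-- For each constraint in the scope of `φ`, its interval or one of the two components of the
complement is claimed. -/
def cover : TPTL AP → TPTL AP
  | atom _ => tt
  | tt => tt
  | ff => tt
  | neg φ => φ.cover
  | and φ ψ => and φ.cover ψ.cover
  | or φ ψ => and φ.cover ψ.cover
  | untl φ ψ => and φ.cover ψ.cover
  | snce φ ψ => and φ.cover ψ.cover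
  | box φ => φ.cover
  | boxPast φ => φ.cover
  | freeze _ => tt
  | ctr I => or (ctr I) (or (ctr I.below) (ctr I.above))

/-- A formula equivalent to `φ` in which true claims are forced to be exact: for each interval of
`φ`, every position is claimed to be inside, below or above. -/
def exact (φ : TPTL AP) : TPTL AP := and φ (and φ.cover (and (box φ.cover) (boxPast φ.cover)))

theorem size_pos (φ : TPTL AP) : 1 ≤ φ.size := by cases φ <;> simp [size]

theorem size_cover_le (φ : TPTL AP) : φ.cover.size ≤ 4 * φ.size := by
  induction φ with
  | ctr I =>
    have h1 := I.size_below_le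
    have h2 := I.size_above_le
    have h3 := I.two_le_size
    simp only [cover, size]
    lia
  | _ => simp only [cover, size]; lia

theorem size_exact_le (φ : TPTL AP) : φ.exact.size ≤ 18 * φ.size := by
  have h1 := φ.size_cover_le
  have h2 := φ.size_pos
  simp only [exact, size]
  lia

theorem not_isLeaf_of_mem_sub_cover {φ χ : TPTL AP} (h : χ ∈ φ.cover.sub) : ¬ χ.IsLeaf := by
  induction φ with
  | atom | tt | ff | freeze =>
    rw [Set.mem_singleton_iff.1 h]
    exact id
  | neg φ ih | box φ ih | boxPast φ ih => exact ih h
  | and φ ψ ih1 ih2 | or φ ψ ih1 ih2 | untl φ ψ ih1 ih2 | snce φ ψ ih1 ih2 =>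
    rcases h with rfl | h | h
    · exact id
    · exact ih1 h
    · exact ih2 h
  | ctr I => rcases h with rfl | rfl | rfl | rfl | rfl <;> exact id

theorem mem_sub_of_mem_sub_exact {φ χ : TPTL AP} (h : χ ∈ φ.exact.sub) (hl : χ.IsLeaf) :
    χ ∈ φ.sub := by
  have hc : χ ∉ φ.cover.sub := fun h' => not_isLeaf_of_mem_sub_cover h' hl
  rcases h with rfl | h | rfl | h | rfl | (rfl | h) | rfl | h
  · exact hl.elim
  · exact h
  · exact hl.elim
  · exact absurd h hc
  · exact hl.elim
  · exact hl.elim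
  · exact absurd h hc
  · exact hl.elim
  · exact absurd h hc

theorem scopeIntervals_cover (φ : TPTL AP) : φ.cover.scopeIntervals =
    φ.scopeIntervals ∪ (TimeInterval.below '' φ.scopeIntervals ∪
      TimeInterval.above '' φ.scopeIntervals) := by
  induction φ with
  | atom | tt | ff | freeze | ctr => simp [cover, scopeIntervals]
  | neg φ ih | box φ ih | boxPast φ ih => exact ih
  | and φ ψ ih1 ih2 | or φ ψ ih1 ih2 | untl φ ψ ih1 ih2 | snce φ ψ ih1 ih2 =>
    simp only [cover, scopeIntervals, ih1, ih2, Set.image_union]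
    ac_rfl

theorem ncard_scopeIntervals_exact_le (φ : TPTL AP) :
    φ.exact.scopeIntervals.ncard ≤ 3 * φ.scopeIntervals.ncard := by
  have h : φ.exact.scopeIntervals = φ.cover.scopeIntervals := by
    simp [exact, scopeIntervals, scopeIntervals_cover]
  rw [h, scopeIntervals_cover]
  have h1 := Set.ncard_image_le (f := TimeInterval.below) φ.finite_scopeIntervals
  have h2 := Set.ncard_image_le (f := TimeInterval.above) φ.finite_scopeIntervals
  refine (Set.ncard_union_le _ _).trans ?_
  have h3 := Set.ncard_union_le (TimeInterval.below '' φ.scopeIntervals)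
    (TimeInterval.above '' φ.scopeIntervals)
  lia

theorem sat_cover {ρ : TimedWord AP} {ν : ℝ} {φ : TPTL AP} {j : ℕ} (hj : j ∈ ρ.dom) :
    Sat ρ φ.cover j ν := by
  induction φ with
  | atom | tt | ff | freeze => exact hj
  | neg φ ih | box φ ih | boxPast φ ih => exact ih
  | and φ ψ ih1 ih2 | or φ ψ ih1 ih2 | untl φ ψ ih1 ih2 | snce φ ψ ih1 ih2 => exact ⟨ih1, ih2⟩
  | ctr I => exact (Classical.em _).imp_right TimeInterval.notMem_toSet_iff.1

theorem sat_exact {ρ : TimedWord AP} {ν : ℝ} {φ : TPTL AP} {j : ℕ} (hj : j ∈ ρ.dom) :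
    Sat ρ φ.exact j ν ↔ Sat ρ φ j ν :=
  and_iff_left ⟨sat_cover hj, fun _ hl _ => sat_cover hl, fun _ hl _ => sat_cover hl⟩

/-- Where a constraint of `φ` is not claimed, the claim that the time is below or above its interval
is true, and so the constraint is false. -/
theorem satC_iff_sat_of_cover {ρ : TimedWord AP} {ν : ℝ} {c : ℕ → Set TimeInterval}
    (hc : ∀ j ∈ ρ.dom, c j ⊆ trueClaims ρ ν j) {φ : TPTL AP}
    (h : ∀ j ∈ ρ.dom, SatC ρ c φ.cover j) {j : ℕ} (hj : j ∈ ρ.dom) :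
    SatC ρ c φ j ↔ Sat ρ φ j ν := by
  induction φ generalizing j with
  | atom | tt | ff | freeze => exact Iff.rfl
  | neg φ ih => exact not_congr (ih h hj)
  | and φ ψ ih1 ih2 =>
    exact and_congr (ih1 (fun l hl => (h l hl).1) hj) (ih2 (fun l hl => (h l hl).2) hj)
  | or φ ψ ih1 ih2 =>
    exact or_congr (ih1 (fun l hl => (h l hl).1) hj) (ih2 (fun l hl => (h l hl).2) hj)
  | untl φ ψ ih1 ih2 =>
    refine exists_congr fun l => and_congr_right fun hl => and_congr_right fun hjl =>
      and_congr (ih2 (fun l hl => (h l hl).2) hl) (forall_congr' fun x => forall_congr' fun hx =>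
        forall_congr' fun hx' => ih1 (fun l hl => (h l hl).1) ⟨?_, ?_⟩)
    · exact hj.1.trans hx.le
    · exact hx'.le.trans hl.2
  | snce φ ψ ih1 ih2 =>
    refine exists_congr fun l => and_congr_right fun hl => and_congr_right fun hjl =>
      and_congr (ih2 (fun l hl => (h l hl).2) hl) (forall_congr' fun x => forall_congr' fun hx =>
        forall_congr' fun hx' => ih1 (fun l hl => (h l hl).1) ⟨?_, ?_⟩)
    · exact hl.1.trans hx.le
    · exact hx'.le.trans hj.2
  | box φ ih | boxPast φ ih =>
    exact forall_congr' fun l => forall_congr' fun hl => forall_congr' fun _ => ih h hl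
  | ctr I =>
    refine ⟨fun hI => hc j hj hI, fun hI => (h j hj).resolve_right fun h' => ?_⟩
    exact TimeInterval.notMem_toSet_iff.2 (h'.imp (fun x => hc j hj x) (fun x => hc j hj x)) hI

theorem robust_exact (φ : TPTL AP) : φ.exact.Robust := by
  rintro ρ i c hi hc ⟨h, h0, h1, h2⟩
  rw [sat_exact hi]
  refine (satC_iff_sat_of_cover hc (fun j hj => ?_) hi).1 h
  rcases lt_trichotomy j i with hlt | rfl | hgt
  · exact h2 j hj hlt
  · exact h0
  · exact h1 j hj hgt

/-! ### Translation of frozen formulae -/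

/-- The PnEMTL formula `β` translates the leaf `χ`, with bounds on its size and arity; `N` bounds the
number of intervals of each scope. -/
structure IsTranslation (N : ℕ) (χ : TPTL AP) (β : PnEMTL AP) : Prop where
  sat_iff : ∀ ρ : TimedWord AP, ∀ i ∈ ρ.dom, χ.Sat ρ i 0 ↔ β.Sat ρ i
  size_le : β.size ≤ 2 ^ (χ.size * (18 * χ.size * (72 * χ.size + 17)))
  arity_le : χ.EachScope (fun s => s.ncard ≤ N) → β.arity ≤ 6 * N + 1
  fut : χ.PosNonAdjacent → β.FutNonAdjacent
  past : χ.NegNonAdjacent → β.PastNonAdjacent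

/-- In negation normal form, the body of a freeze quantifier is used as it is, which preserves
non-adjacency; otherwise its claims are made exact. -/
theorem exists_robust_body (φ : TPTL AP) :
    ∃ θ : TPTL AP, θ.Robust ∧
      (∀ ρ : TimedWord AP, ∀ i ∈ ρ.dom, ∀ ν, θ.Sat ρ i ν ↔ φ.Sat ρ i ν) ∧
      θ.size ≤ 18 * φ.size ∧ (∀ χ ∈ θ.sub, χ.IsLeaf → χ ∈ φ.sub) ∧
      θ.scopeIntervals.ncard ≤ 3 * φ.scopeIntervals.ncard ∧
      (φ.IsNNF → θ.scopeIntervals = φ.scopeIntervals) := by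
  by_cases h : φ.IsNNF
  · exact ⟨φ, h.robust, fun _ _ _ _ => Iff.rfl, by lia, fun _ h _ => h, by lia, fun _ => rfl⟩
  · exact ⟨φ.exact, φ.robust_exact, fun _ _ hi _ => sat_exact hi, φ.size_exact_le,
      fun _ => mem_sub_of_mem_sub_exact, φ.ncard_scopeIntervals_exact_le, fun h' => absurd h' h⟩

theorem exists_natInter_choice (B : ℕ) :
    ∃ K : Set TimeInterval → {I : TimeInterval // I.IsNat}, ∀ D : Set TimeInterval, D.Finite →
      (∀ I ∈ D, I.size ≤ B) → TimeInterval.IsNatInter D (K D).1 ∧ (K D).1.size ≤ 2 * B + 2 := by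
  have h : ∀ D : Set TimeInterval, ∃ I : {I : TimeInterval // I.IsNat}, D.Finite →
      (∀ I ∈ D, I.size ≤ B) → TimeInterval.IsNatInter D I.1 ∧ I.1.size ≤ 2 * B + 2 := by
    intro D
    by_cases hD : D.Finite ∧ ∀ I ∈ D, I.size ≤ B
    · obtain ⟨I, hI, hIB⟩ := TimeInterval.exists_isNatInter hD.1 hD.2
      exact ⟨⟨I, hI.isNat⟩, fun _ _ => ⟨hI, hIB⟩⟩
    · exact ⟨⟨.nonneg, TimeInterval.isNat_nonneg⟩, fun h1 h2 => absurd ⟨h1, h2⟩ hD⟩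
  choose K hK using h
  exact ⟨K, hK⟩

/-- The exponent in the size bound is `n * q n` with `q` monotone, and the modalities of one freeze
quantifier multiply the size of their arguments by at most `2 ^ q n`. -/
theorem exists_isTranslation_freeze (N : ℕ) (φ : TPTL AP)
    (ih : ∀ χ ∈ φ.sub, χ.IsLeaf → ∃ β, IsTranslation N χ β) :
    ∃ β, IsTranslation N (freeze φ) β := by
  obtain ⟨θ, hrob, hsat, hsize, hleaf, hcard, hscope⟩ := exists_robust_body φ
  -- Enumerate the leaves of `θ` and choose their translations.
  have hfin : {χ | χ ∈ θ.sub ∧ χ.IsLeaf}.Finite := θ.finite_sub.subset fun _ h => h.1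
  have : Finite {χ | χ ∈ θ.sub ∧ χ.IsLeaf} := hfin
  set e := Finite.equivFin {χ | χ ∈ θ.sub ∧ χ.IsLeaf} with he
  set m := Nat.card {χ | χ ∈ θ.sub ∧ χ.IsLeaf} with hm
  have hmle : m ≤ θ.size :=
    (Set.ncard_le_ncard (fun _ h => h.1) θ.finite_sub).trans θ.ncard_sub_le
  set lf : Fin m → TPTL AP := fun j => (e.symm j).1 with hlf
  have hlf1 : ∀ j, lf j ∈ θ.sub ∧ (lf j).IsLeaf := fun j => (e.symm j).2
  have hlf2 : ∀ χ ∈ θ.sub, χ.IsLeaf → ∃ j, lf j = χ := fun χ h1 h2 =>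
    ⟨e ⟨χ, h1, h2⟩, by simp [hlf]⟩
  have hlf3 : ∀ j, lf j ∈ φ.sub := fun j => hleaf _ (hlf1 j).1 (hlf1 j).2
  choose S hS using fun j => ih (lf j) (hlf3 j) (hlf1 j).2
  obtain ⟨K, hKall⟩ := exists_natInter_choice θ.size
  have hK1 : ∀ q : θ.State, TimeInterval.IsNatInter q.claims (K q.claims).1 ∧
      (K q.claims).1.size ≤ 2 * θ.size + 2 := fun q =>
    hKall _ (θ.finite_scopeIntervals.subset q.claims_subset) fun I hI =>
      size_le_of_mem_scopeIntervals (q.claims_subset hI)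
  have hK2 : ∀ q : θ.State, TimeInterval.IsNatInter q.pastClaims (K q.pastClaims).1 ∧
      (K q.pastClaims).1.size ≤ 2 * θ.size + 2 := fun q =>
    hKall _ ((θ.finite_scopeIntervals.subset q.claims_subset).image _) (by
      rintro _ ⟨I, hI, rfl⟩
      rw [TimeInterval.size_neg]
      exact size_le_of_mem_scopeIntervals (q.claims_subset hI))
  have hSsat : ∀ ρ : TimedWord AP, ∀ i ∈ ρ.dom, ∀ j, (lf j).Sat ρ i 0 ↔ (S j).Sat ρ i :=
    fun ρ i hi j => (hS j).sat_iff ρ i hi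
  refine ⟨θ.freezeFormula lf K S, ⟨fun ρ i hi => ?_, ?_, fun hN => ?_, fun h => ?_, fun h => ?_⟩⟩
  · refine (hsat ρ i hi _).symm.trans ⟨?_, ?_⟩
    · exact sat_freezeFormula_of_sat hlf1 hSsat (fun q => (hK1 q).1) (fun q => (hK2 q).1) hi
    · exact sat_of_sat_freezeFormula hrob hlf2 hSsat (fun q => (hK1 q).1) (fun q => (hK2 q).1) hi
  · have hX : ∀ j, (S j).size ≤ 2 ^ (φ.size * (18 * φ.size * (72 * φ.size + 17))) := fun j => by
      have h1 := size_le_of_mem_sub (hlf3 j)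
      exact (hS j).size_le.trans (Nat.pow_le_pow_right (by lia) (by gcongr))
    refine (size_freezeFormula_le hmle (Nat.one_le_two_pow) hX (fun q => (hK1 q).2)
      (fun q => (hK2 q).2)).trans ?_
    rw [← pow_add]
    refine Nat.pow_le_pow_right (by lia) ?_
    calc θ.size * (4 * θ.size + 17) + φ.size * (18 * φ.size * (72 * φ.size + 17))
        ≤ 18 * φ.size * (4 * (18 * φ.size) + 17) +
          φ.size * (18 * φ.size * (72 * φ.size + 17)) := by gcongr
      _ = (φ.size + 1) * (18 * φ.size * (72 * φ.size + 17)) := by ring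
      _ ≤ (φ.size + 1) * (18 * (φ.size + 1) * (72 * (φ.size + 1) + 17)) := by gcongr <;> lia
  · refine arity_freezeFormula_le ?_ fun j => (hS j).arity_le (hN.2.of_mem_sub (hlf3 j))
    have h1 : φ.scopeIntervals.ncard ≤ N := hN.1
    rw [cutArity]
    lia
  · have h1 : φ.IsNNF := h.1
    refine futNonAdjacent_freezeFormula ?_ (fun q => (hK1 q).1) fun j =>
      (hS j).fut ⟨h1.of_mem_sub (hlf3 j), h.2.2.of_mem_sub (hlf3 j)⟩
    rw [hscope h1]
    exact h.2.1
  · have h1 : φ.IsNNF := h.1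
    refine pastNonAdjacent_freezeFormula ?_ (fun q => (hK2 q).1) fun j =>
      (hS j).past ⟨h1.of_mem_sub (hlf3 j), h.2.2.of_mem_sub (hlf3 j)⟩
    rw [hscope h1]
    exact h.2.1

/-- Leaves are translated from the inside out: the leaves of the body of a freeze quantifier are the
arguments of the modalities that translate the quantifier. -/
theorem exists_isTranslation (N : ℕ) (φ : TPTL AP) :
    ∀ χ ∈ φ.sub, χ.IsLeaf → ∃ β, IsTranslation N χ β := by
  induction φ with
  | atom a =>
    rintro _ rfl -
    exact ⟨.atom a, fun _ _ _ => Iff.rfl, Nat.one_le_two_pow, fun _ => Nat.zero_le _,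
      fun _ => trivial, fun _ => trivial⟩
  | tt | ff | ctr =>
    rintro _ rfl hl
    exact hl.elim
  | freeze φ ih =>
    rintro _ rfl -
    exact exists_isTranslation_freeze N φ ih
  | neg φ ih | box φ ih | boxPast φ ih =>
    rintro χ (rfl | h) hl
    · exact hl.elim
    · exact ih χ h hl
  | and φ ψ ih1 ih2 | or φ ψ ih1 ih2 | untl φ ψ ih1 ih2 | snce φ ψ ih1 ih2 =>
    rintro χ (rfl | h | h) hl
    · exact hl.elim
    · exact ih1 χ h hl
    · exact ih2 χ h hl

/-! ### Constraints bound by no quantifier -/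

/-- `J` contains the time elapsed since the first position. This is expressed by freezing the current
time and reading the reflected constraint at the first position, which is the one without
predecessors. -/
def sinceStart (J : TimeInterval) : TPTL AP :=
  freeze (or (and (boxPast ff) (ctr J.neg)) (snce tt (and (boxPast ff) (ctr J.neg))))

/-- Replaces the constraints that lie under no freeze quantifier. Each is split into two half-lines
in separate scopes, so that the new scopes are non-adjacent. -/
def close : TPTL AP → TPTL AP
  | atom a => atom a
  | tt => tt
  | ff => ff
  | neg φ => neg φ.close
  | and φ ψ => and φ.close ψ.close
  | or φ ψ => or φ.close ψ.close
  | untl φ ψ => untl φ.close ψ.close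
  | snce φ ψ => snce φ.close ψ.close
  | box φ => box φ.close
  | boxPast φ => boxPast φ.close
  | freeze φ => freeze φ
  | ctr I => and (sinceStart ⟨I.lower, .infinite⟩) (sinceStart ⟨.infinite, I.upper⟩)

theorem sat_sinceStart {ρ : TimedWord AP} {J : TimeInterval} {j : ℕ} {ν : ℝ} (hj : j ∈ ρ.dom) :
    (sinceStart J).Sat ρ j ν ↔ ρ.time j ∈ J.toSet := by
  have hfirst : ∀ l ∈ ρ.dom, (and (boxPast ff) (ctr J.neg)).Sat ρ l (ρ.time j) ↔
      l = 1 ∧ ρ.time j ∈ J.toSet := by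
    intro l hl
    have h1 : (boxPast ff).Sat ρ l (ρ.time j) ↔ l = 1 := by
      constructor
      · intro h
        by_contra hne
        have := hl.1
        exact h 1 ⟨le_rfl, ρ.len_pos⟩ (by lia)
      · rintro rfl x hx hx'
        exact absurd hx.1 (not_le.2 hx')
    refine (and_congr_left' h1).trans (and_congr_right ?_)
    rintro rfl
    change ρ.time 1 - ρ.time j ∈ J.neg.toSet ↔ _
    rw [TimeInterval.mem_toSet_neg, ρ.time_one, zero_sub, neg_neg]
  refine (or_congr (hfirst j hj) (d := 1 < j ∧ ρ.time j ∈ J.toSet) ?_).trans ?_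
  · constructor
    · rintro ⟨l, hl, hlj, h, -⟩
      obtain ⟨rfl, h'⟩ := (hfirst l hl).1 h
      exact ⟨hlj, h'⟩
    · rintro ⟨h1, h⟩
      have hd : 1 ∈ ρ.dom := ⟨le_rfl, ρ.len_pos⟩
      exact ⟨1, hd, h1, (hfirst 1 hd).2 ⟨rfl, h⟩, fun x hx hx' =>
        ⟨hx.le, hx'.le.trans hj.2⟩⟩
  · rw [← or_and_right]
    exact and_iff_right (by have := hj.1; lia)

theorem sat_close {ρ : TimedWord AP} {φ : TPTL AP} {j : ℕ} {ν : ℝ} (hj : j ∈ ρ.dom) :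
    φ.close.Sat ρ j ν ↔ φ.Sat ρ j 0 := by
  induction φ generalizing j with
  | atom | tt | ff | freeze => exact Iff.rfl
  | neg φ ih => exact not_congr (ih hj)
  | and φ ψ ih1 ih2 => exact and_congr (ih1 hj) (ih2 hj)
  | or φ ψ ih1 ih2 => exact or_congr (ih1 hj) (ih2 hj)
  | untl φ ψ ih1 ih2 =>
    exact exists_congr fun l => and_congr_right fun hl => and_congr_right fun hjl =>
      and_congr (ih2 hl) (forall_congr' fun x => forall_congr' fun hx =>
        forall_congr' fun hx' => ih1 ⟨hj.1.trans hx.le, hx'.le.trans hl.2⟩)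
  | snce φ ψ ih1 ih2 =>
    exact exists_congr fun l => and_congr_right fun hl => and_congr_right fun hjl =>
      and_congr (ih2 hl) (forall_congr' fun x => forall_congr' fun hx =>
        forall_congr' fun hx' => ih1 ⟨hl.1.trans hx.le, hx'.le.trans hj.2⟩)
  | box φ ih | boxPast φ ih =>
    exact forall_congr' fun l => forall_congr' fun hl => forall_congr' fun _ => ih hl
  | ctr I =>
    refine (and_congr (sat_sinceStart hj) (sat_sinceStart hj)).trans ?_
    change _ ↔ ρ.time j - 0 ∈ I.toSet
    simp only [TimeInterval.mem_toSet, sub_zero]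
    exact and_congr (and_iff_left trivial) (and_iff_right trivial)

theorem size_close_le (φ : TPTL AP) : φ.close.size ≤ 12 * φ.size := by
  induction φ with
  | ctr I =>
    have h1 := I.two_le_size
    simp only [TimeInterval.size] at h1
    simp only [close, sinceStart, size, TimeInterval.size_neg]
    simp only [TimeInterval.size, Endpoint.size]
    lia
  | _ => simp only [close, size]; lia

theorem scopeIntervals_close (φ : TPTL AP) : φ.close.scopeIntervals = ∅ := by
  induction φ <;> simp_all [close, scopeIntervals, sinceStart]

theorem IsNNF.close {φ : TPTL AP} (h : φ.IsNNF) : φ.close.IsNNF := by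
  induction φ with
  | atom | tt | ff | freeze => exact h
  | ctr => simp [TPTL.close, sinceStart, IsNNF]
  | neg φ =>
    obtain ⟨a, rfl⟩ := h
    exact ⟨a, rfl⟩
  | box φ ih | boxPast φ ih => exact ih h
  | and φ ψ ih1 ih2 | or φ ψ ih1 ih2 | untl φ ψ ih1 ih2 | snce φ ψ ih1 ih2 =>
    exact ⟨ih1 h.1, ih2 h.2⟩

theorem EachScope.close {R : Set TimeInterval → Prop} {φ : TPTL AP} (h : φ.EachScope R)
    (hl : ∀ e, R {⟨e, .infinite⟩}) (hu : ∀ e, R {⟨.infinite, e⟩}) : φ.close.EachScope R := by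
  induction φ with
  | atom | tt | ff | freeze => exact h
  | ctr I =>
    simpa [TPTL.close, sinceStart, EachScope, scopeIntervals, TimeInterval.neg, Endpoint.neg] using
      ⟨hu _, hl _⟩
  | neg φ ih | box φ ih | boxPast φ ih => exact ih h
  | and φ ψ ih1 ih2 | or φ ψ ih1 ih2 | untl φ ψ ih1 ih2 | snce φ ψ ih1 ih2 =>
    exact ⟨ih1 h.1, ih2 h.2⟩

theorem EachScope.mono {R R' : Set TimeInterval → Prop} {φ : TPTL AP} (h : φ.EachScope R)
    (hR : ∀ s, R s → R' s) : φ.EachScope R' := by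
  induction φ <;> simp_all [EachScope]

theorem eachScope_of_subset_intervals {R : Set TimeInterval → Prop} {φ : TPTL AP}
    (h : ∀ s ⊆ φ.intervals, R s) : φ.EachScope R := by
  induction φ with
  | atom | tt | ff | ctr => trivial
  | freeze φ ih => exact ⟨h _ φ.scopeIntervals_subset, ih h⟩
  | neg φ ih | box φ ih | boxPast φ ih => exact ih h
  | and φ ψ ih1 ih2 | or φ ψ ih1 ih2 | untl φ ψ ih1 ih2 | snce φ ψ ih1 ih2 =>
    exact ⟨ih1 fun s hs => h s (hs.trans Set.subset_union_left),
      ih2 fun s hs => h s (hs.trans Set.subset_union_right)⟩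

end TPTL

theorem TimeInterval.nonAdjacent_empty : NonAdjacent ∅ := fun _ h => h.elim

theorem TimeInterval.nonAdjacent_singleton_lower (e : Endpoint) :
    NonAdjacent {⟨e, .infinite⟩} := by
  rintro _ rfl _ rfl
  rcases e with _ | a | a <;> simp [inf, sup]

theorem TimeInterval.nonAdjacent_singleton_upper (e : Endpoint) :
    NonAdjacent {⟨.infinite, e⟩} := by
  rintro _ rfl _ rfl
  rcases e with _ | a | a <;> simp [inf, sup]

theorem mainTheorem4 :
    ∃ (P : Polynomial ℕ) (C : ℕ), ∀ (AP : Type*) [Finite AP] (φ : TPTL AP),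
      ∃ α : PnEMTL AP,
        (∀ (ρ : TimedWord AP), ∀ i ∈ ρ.dom, φ.Sat ρ i 0 ↔ α.Sat ρ i) ∧
        α.size ≤ 2 ^ P.eval φ.size ∧
        α.arity ≤ C * max 1 (φ.intervals.ncard ^ 2) ∧
        (φ.NonAdjacent → α.NonAdjacent) ∧
        (φ.PosNonAdjacent → α.PosNonAdjacent) ∧
        (φ.NegNonAdjacent → α.NegNonAdjacent) := by
  refine ⟨13 * Polynomial.X * (18 * (13 * Polynomial.X) * (72 * (13 * Polynomial.X) + 17)), 7,
    fun AP _ φ => ?_⟩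
  set N := max 1 φ.intervals.ncard with hN
  obtain ⟨α, hα⟩ := TPTL.exists_isTranslation N (.freeze φ.close) _ (TPTL.self_mem_sub _) trivial
  have hpos : φ.PosNonAdjacent → α.FutNonAdjacent := fun h =>
    hα.fut ⟨h.1.close,
      by
        rw [TPTL.scopeIntervals_close]
        exact .of_nonAdjacent TimeInterval.nonAdjacent_empty,
      h.2.close (fun e => .of_nonAdjacent (TimeInterval.nonAdjacent_singleton_lower e))
        (fun e => .of_nonAdjacent (TimeInterval.nonAdjacent_singleton_upper e))⟩
  have hneg : φ.NegNonAdjacent → α.PastNonAdjacent := fun h =>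
    hα.past ⟨h.1.close,
      by
        rw [TPTL.scopeIntervals_close]
        exact .of_nonAdjacent TimeInterval.nonAdjacent_empty,
      h.2.close (fun e => .of_nonAdjacent (TimeInterval.nonAdjacent_singleton_lower e))
        (fun e => .of_nonAdjacent (TimeInterval.nonAdjacent_singleton_upper e))⟩
  refine ⟨α, fun ρ i hi => (TPTL.sat_close hi).symm.trans (hα.sat_iff ρ i hi), hα.size_le.trans ?_,
    (hα.arity_le ⟨?_, ?_⟩).trans ?_, fun h => ⟨?_, ?_⟩, hpos, hneg⟩
  · refine Nat.pow_le_pow_right (by lia) ?_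
    have h1 : (TPTL.freeze φ.close).size ≤ 13 * φ.size := by
      have h2 := φ.size_close_le
      have h3 := φ.size_pos
      simp only [TPTL.size]
      lia
    simp only [Polynomial.eval_mul, Polynomial.eval_add, Polynomial.eval_X,
      Polynomial.eval_ofNat]
    gcongr
  · rw [TPTL.scopeIntervals_close]
    exact (Set.ncard_empty _).trans_le (Nat.zero_le _)
  · refine (TPTL.eachScope_of_subset_intervals fun s hs => ?_).close (fun e => ?_) fun e => ?_
    · exact (Set.ncard_le_ncard hs φ.intervals_finite).trans (le_max_right _ _)
    · rw [Set.ncard_singleton]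
      exact le_max_left _ _
    · rw [Set.ncard_singleton]
      exact le_max_left _ _
  · have h1 : N ≤ max 1 (φ.intervals.ncard ^ 2) :=
      max_le_max le_rfl (Nat.le_self_pow two_ne_zero _)
    have h2 : 1 ≤ N := le_max_left _ _
    lia
  · exact hpos ⟨h.1, h.2.mono fun _ => .of_nonAdjacent⟩
  · exact hneg ⟨h.1, h.2.mono fun _ => .of_nonAdjacent⟩
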